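/- Let $k$ be a field and let $Q$ be a strongly locally finite quiver: every vertex is the source and the target of only finitely many arrows, and for all vertices $x,y$ there are only finitely many paths from $x$ to $y$. Let $\mathrm{Rep}(Q)$ be the category of representations of $Q$ over $k$. For a vertex $a$, let $P_a$ be the representation with $P_a(x)$ the $k$-space with basis the paths from $a$ to $x$, arrows acting by composition, and let $I_a$ be the representation with $I_a(x)$ the dual of the $k$-space with basis the paths from $x$ to $a$, arrows acting by transposes. Let $\mathrm{rep}^+(Q)$ (resp. $\mathrm{rep}^-(Q)$) be the full subcategory of finitely presented (resp. finitely co-presented) representations, i.e. the cokernels of morphisms between finite direct sums of $P_a$'s (resp. the kernels of morphisms between finite direct sums of $I_a$'s). Let $\mathrm{rrep}(Q)$ be the full subcategory of the representations $M$, with all $M(x)$ finite dimensional, for which there is a short exact sequence $0\to L\to M\to N\to 0$ with $L\in\mathrm{rep}^+(Q)$ and $N\in\mathrm{rep}^-(Q)$ such that all but finitely many arrows $\alpha$ with $M(\alpha)\neq 0$ satisfy $(L\oplus N)(\alpha)\neq 0$. The support of $M$ is the full subquiver on the vertices $x$ with $M(x)\ne 0$. A quiver is top-finite (resp. socle-finite)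 if it has finitely many sources (resp. sinks) and each vertex is a successor of a source (resp. a predecessor of a sink). A full subquiver $\Omega$ of a quiver $\Sigma$ is successor-closed (resp. predecessor-closed) in $\Sigma$ if every path in $\Sigma$ that starts (resp. ends) in $\Omega$ also ends (resp. starts) in $\Omega$, and it is co-finite in $\Sigma$ if only finitely many vertices of $\Sigma$ are not in $\Omega$. For a full subquiver $\Omega$ of $Q$, $M_\Omega$ is the restriction of $M$ to $\Omega$, extended by zero to a representation of $Q$. "Projective" means being a projective object of $\mathrm{rep}^+(Q)$ and "injective" means being an injective object of $\mathrm{rep}^-(Q)$. $M$ is indecomposable up to projectives and injectives if, whenever $M\cong M_1\oplus M_2$, one of $M_1,M_2$ is projective in $\mathrm{rep}^+(Q)$ or injective in $\mathrm{rep}^-(Q)$. Let $0\neq M\in\mathrm{rrep}(Q)$ have support $\Sigma$. Then there exist full subquivers $\Sigma_P$ and $\Sigma_I$ of $\Sigma$ such that (1) $\Sigma_P$ is top-finite and successor-closed in $\Sigma$, and $M_{\Sigma_P}$ is projective; (2) $\Sigma_I$ is socle-finite and predecessor-closed in $\Sigma\setminus\Sigma_P$, and $M_{\Sigma_I}$ is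 injective; (3) $\Omega:=\Sigma\setminus(\Sigma_P\cup\Sigma_I)$ is finite and non-empty; (4) if $M$ is indecomposable, then so is $M_\Omega$; and if $M_\Omega$ is indecomposable, then $M$ is indecomposable up to projectives and injectives. Moreover, whenever $\Sigma_P'$ is co-finite and successor-closed in $\Sigma_P$ and $\Sigma_I'$ is co-finite and predecessor-closed in $\Sigma_I$, the pair $\Sigma_P',\Sigma_I'$ also satisfies (1)–(4) (with $\Omega$ replaced by $\Sigma\setminus(\Sigma_P'\cup\Sigma_I')$). -/

import Mathlib

open CategoryTheory CategoryTheory.Limits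

universe u v w

namespace QuiverRep

noncomputable section

/-! ## Quivers and full subquivers

A full subquiver of `Q` is given by its set of vertices. -/

/-- A strongly locally finite quiver: every vertex is the source and the target of only finitely
many arrows, and there are only finitely many paths between any two vertices. -/
structure StronglyLocallyFinite (Q : Type v) [Quiver.{w} Q] : Prop where
  finite_out : ∀ x : Q, Finite (Σ y : Q, (x ⟶ y))
  finite_in : ∀ x : Q, Finite (Σ y : Q, (y ⟶ x))
  finite_paths : ∀ x y : Q, Finite (Quiver.Path x y)

section Subquivers

variable {Q : Type v} [Quiver.{w} Q]

/-- There is a (possibly trivial) path from `x` to `y` in the full subquiver on `S`. -/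
def Reach (S : Set Q) (x y : Q) : Prop :=
  x ∈ S ∧ Relation.ReflTransGen (fun a b : Q => b ∈ S ∧ Nonempty (a ⟶ b)) x y

/-- `x` is a source vertex of the full subquiver on `S`. -/
def IsSourceIn (S : Set Q) (x : Q) : Prop :=
  x ∈ S ∧ ∀ y ∈ S, IsEmpty (y ⟶ x)

/-- `x` is a sink vertex of the full subquiver on `S`. -/
def IsSinkIn (S : Set Q) (x : Q) : Prop :=
  x ∈ S ∧ ∀ y ∈ S, IsEmpty (x ⟶ y)

/-- Finitely many source vertices, and every vertex is a successor of a source vertex. -/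
def TopFinite (S : Set Q) : Prop :=
  {x | IsSourceIn S x}.Finite ∧ ∀ x ∈ S, ∃ s, IsSourceIn S s ∧ Reach S s x

/-- Finitely many sink vertices, and every vertex is a predecessor of a sink vertex. -/
def SocleFinite (S : Set Q) : Prop :=
  {x | IsSinkIn S x}.Finite ∧ ∀ x ∈ S, ∃ s, IsSinkIn S s ∧ Reach S x s

/-- `T` is a successor-closed full subquiver of `S`. -/
def SuccessorClosedIn (T S : Set Q) : Prop :=
  T ⊆ S ∧ ∀ x y : Q, Reach S x y → x ∈ T → y ∈ T

/-- `T` is a predecessor-closed full subquiver of `S`. -/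
def PredecessorClosedIn (T S : Set Q) : Prop :=
  T ⊆ S ∧ ∀ x y : Q, Reach S x y → y ∈ T → x ∈ T

/-- `T` is a co-finite full subquiver of `S`. -/
def CofiniteIn (T S : Set Q) : Prop :=
  T ⊆ S ∧ (S \ T).Finite

end Subquivers

/-! ## Representations -/

/-- The category of all representations of `Q` over `k`: functors from the path category of `Q`
to `k`-vector spaces. -/
abbrev Repr (k : Type u) [Field k] (Q : Type v) [Quiver.{w} Q] :=
  Paths Q ⥤ ModuleCat.{max u v w} k

variable {k : Type u} [Field k] {Q : Type v} [Quiver.{w} Q]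

/-- The vector space `M(x)` at a vertex `x`. -/
abbrev space (M : Repr k Q) (x : Q) : ModuleCat.{max u v w} k :=
  M.obj ((Paths.of Q).obj x)

/-- The linear map `M(α)` at an arrow `α`. -/
abbrev arrowMap (M : Repr k Q) {x y : Q} (α : x ⟶ y) : space M x ⟶ space M y :=
  M.map ((Paths.of Q).map α)

/-- Local finite dimensionality: `M(x)` is finite dimensional for every vertex `x`. -/
def LocallyFiniteDimensional (M : Repr k Q) : Prop :=
  ∀ x : Q, FiniteDimensional k (space M x)

/-- The (vertex set of the) support of `M`. -/
def supp (M : Repr k Q) : Set Q :=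
  {x | Nontrivial (space M x)}

/-- `M` is supported by the arrow `α`. -/
def SupportedByArrow (M : Repr k Q) {x y : Q} (α : x ⟶ y) : Prop :=
  arrowMap M α ≠ 0

/-- The representation `P_a`: `P_a(x)` has the paths from `a` to `x` as a basis, and an arrow
acts by appending it. -/
def projRep (k : Type u) [Field k] (Q : Type v) [Quiver.{w} Q] (a : Q) : Repr k Q :=
  Paths.lift
    { obj := fun x : Q => ModuleCat.of k (Quiver.Path a x →₀ k)
      map := fun {_ _} α =>
        ModuleCat.ofHom (Finsupp.lmapDomain k k (fun p : Quiver.Path a _ => p.comp α.toPath)) }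

/-- The representation `I_a`: `I_a(x)` is the dual of the space with the paths from `x` to `a` as
a basis (so it consists of the functions on these paths), and an arrow acts by the transpose of
prepending it. -/
def injRep (k : Type u) [Field k] (Q : Type v) [Quiver.{w} Q] (a : Q) : Repr k Q :=
  Paths.lift
    { obj := fun x : Q => ModuleCat.of k (Quiver.Path x a → k)
      map := fun {_ _} α =>
        ModuleCat.ofHom (LinearMap.funLeft k k (fun p : Quiver.Path _ a => α.toPath.comp p)) }

instance : HasFiniteBiproducts (Repr k Q) :=
  Abelian.hasFiniteBiproducts

/-- The finitely presented representations: those `M` with an exact sequence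
`⨁ P_{x_i} ⟶ ⨁ P_{y_j} ⟶ M ⟶ 0` with finite sums. -/
def repPlus (k : Type u) [Field k] (Q : Type v) [Quiver.{w} Q] :
    ObjectProperty (Repr k Q) := fun M =>
  ∃ (m n : ℕ) (x : Fin m → Q) (y : Fin n → Q)
    (f : (⨁ fun i => projRep k Q (x i)) ⟶ ⨁ fun j => projRep k Q (y j))
    (g : (⨁ fun j => projRep k Q (y j)) ⟶ M) (h : f ≫ g = 0),
    (ShortComplex.mk f g h).Exact ∧ Epi g

/-- The finitely co-presented representations: those `M` with an exact sequence
`0 ⟶ M ⟶ ⨁ I_{x_i} ⟶ ⨁ I_{y_j}` with finite sums. -/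
def repMinus (k : Type u) [Field k] (Q : Type v) [Quiver.{w} Q] :
    ObjectProperty (Repr k Q) := fun M =>
  ∃ (m n : ℕ) (x : Fin m → Q) (y : Fin n → Q)
    (f : M ⟶ ⨁ fun i => injRep k Q (x i))
    (g : (⨁ fun i => injRep k Q (x i)) ⟶ ⨁ fun j => injRep k Q (y j)) (h : f ≫ g = 0),
    (ShortComplex.mk f g h).Exact ∧ Mono f

/-- `M` is a finite extension-representation of `N` by `L`: there is a short exact sequence
`0 ⟶ L ⟶ M ⟶ N ⟶ 0`, and all but finitely many arrows supporting `M` support `L ⊕ N`. -/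
def IsFiniteExtension (L M N : Repr k Q) : Prop :=
  (∃ (f : L ⟶ M) (g : M ⟶ N) (h : f ≫ g = 0), (ShortComplex.mk f g h).ShortExact) ∧
    {e : Σ (x : Q) (y : Q), (x ⟶ y) |
      SupportedByArrow M e.2.2 ∧ ¬ SupportedByArrow (L ⊞ N) e.2.2}.Finite

/-- The category `rrep(Q)`: locally finite dimensional representations that are finite
extension-representations of a finitely co-presented representation by a finitely presented
one. -/
def rrep (k : Type u) [Field k] (Q : Type v) [Quiver.{w} Q] :
    ObjectProperty (Repr k Q) := fun M =>
  LocallyFiniteDimensional M ∧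
    ∃ L N : Repr k Q, repPlus k Q L ∧ repMinus k Q N ∧ IsFiniteExtension L M N

/-! ## Restriction to a full subquiver -/

/-- All of `M(x)` if `x ∈ S`, and zero otherwise. -/
def restrictSpace (M : Repr k Q) (S : Set Q) (x : Q) : Submodule k (space M x) where
  carrier := {m | x ∉ S → m = 0}
  add_mem' := fun ha hb hx => by rw [ha hx, hb hx, add_zero]
  zero_mem' := fun _ => rfl
  smul_mem' := fun c _ ha hx => by rw [ha hx, smul_zero]

open Classical in
/-- `M(α)` if both ends of `α` lie in `S`, and zero otherwise. -/
def restrictMap (M : Repr k Q) (S : Set Q) {x y : Q} (α : x ⟶ y) :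
    restrictSpace M S x →ₗ[k] restrictSpace M S y :=
  if hy : y ∈ S then
    ((arrowMap M α).hom.comp (restrictSpace M S x).subtype).codRestrict (restrictSpace M S y)
      (fun _ h => absurd hy h)
  else 0

/-- The restriction `M_S` of `M` to the full subquiver on `S`, seen as a representation of `Q`
that vanishes outside `S`. -/
def restrict (M : Repr k Q) (S : Set Q) : Repr k Q :=
  Paths.lift
    { obj := fun x : Q => ModuleCat.of k (restrictSpace M S x)
      map := fun {_ _} α => ModuleCat.ofHom (restrictMap M S α) }

/-! ## Projectives, injectives, indecomposables -/

/-- `M` is a projective object of `rep⁺(Q)`. -/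
def IsProjective (M : Repr k Q) : Prop :=
  ∃ h : repPlus k Q M, Projective (⟨M, h⟩ : (repPlus k Q).FullSubcategory)

/-- `M` is an injective object of `rep⁻(Q)`. -/
def IsInjective (M : Repr k Q) : Prop :=
  ∃ h : repMinus k Q M, Injective (⟨M, h⟩ : (repMinus k Q).FullSubcategory)

/-- In every decomposition `M = M₁ ⊕ M₂`, one of `M₁`, `M₂` is projective in `rep⁺(Q)` or
injective in `rep⁻(Q)`. -/
def IndecomposableUpToProjInj (M : Repr k Q) : Prop :=
  ∀ M₁ M₂ : Repr k Q, Nonempty (M ≅ M₁ ⊞ M₂) →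
    (IsProjective M₁ ∨ IsInjective M₁) ∨ (IsProjective M₂ ∨ IsInjective M₂)

/-- The full subquivers `SP` and `SI` split the support of `M` into a projective part, an
injective part and a finite non-empty remainder that controls the decompositions of `M`. -/
structure IsSplitting (M : Repr k Q) (SP SI : Set Q) : Prop where
  topFinite : TopFinite SP
  successorClosed : SuccessorClosedIn SP (supp M)
  projective : IsProjective (restrict M SP)
  socleFinite : SocleFinite SI
  predecessorClosed : PredecessorClosedIn SI (supp M \ SP)
  injective : IsInjective (restrict M SI)
  finite : (supp M \ (SP ∪ SI)).Finite
  nonempty : (supp M \ (SP ∪ SI)).Nonempty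
  indecomposable : Indecomposable M → Indecomposable (restrict M (supp M \ (SP ∪ SI)))
  indecomposableUpTo :
    Indecomposable (restrict M (supp M \ (SP ∪ SI))) → IndecomposableUpToProjInj M

end

end QuiverRep

-- Choose `0 → L → M → N → 0` as in the definition of `rrep`. A nontrivial path has a unique last
-- arrow, so `P_a` is free at each vertex `y ≠ a`: the space at `y` is the direct sum, along the
-- arrows ending in `y`, of the spaces at their sources. Freeness passes to finite sums and
-- cokernels, so `L` is free outside a finite set `F` and lives on the successors `U` of `F`.
-- Dually, `N` is cofree outside a finite set `G` and lives on the predecessors `V` of `G`. Strong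
-- local finiteness makes `U ∩ V` finite, and only finitely many arrows support `M` without
-- supporting `L ⊕ N`. Away from a finite set of vertices, `M` therefore agrees with `L` on `U`,
-- with `N` on `V`, and no arrow mixes the two.
--
-- This gives a successor-closed `SP ⊆ U` where `M` is free relative to `U`, and a
-- predecessor-closed `SI ⊆ V` where `M` is cofree relative to `V`, with finite remainder `Ω` in the
-- support (`exists_isFreeCofreePair`). By recursion on path length, `M` on `SP` is freely generated
-- by what enters through the finitely many arrows from outside. So `M_SP` is a finite sum of
-- `P_y`'s, and a morphism on `SP` is the same as arbitrary data on the entering arrows. Dually for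
-- `SI`.
--
-- Consequently restriction `End(M) → End(M_Ω)` is bijective and multiplicative. Idempotents
-- correspond, so `M` is indecomposable if and only if `M_Ω` is, which is more than (4) asks. All of
-- this uses only `IsFreeCofreePair`, a condition inherited with the same `U` and `V` by co-finite
-- closed parts of `SP` and `SI`; this is the last claim of the theorem.

universe t

namespace QuiverRep

noncomputable section

variable {k : Type u} [Field k] {Q : Type v} [Quiver.{w} Q]

/-! ## Morphisms of representations, vertex by vertex -/

/-- The component of a morphism of representations at a vertex. -/
abbrev vmap {M N : Repr k Q} (f : M ⟶ N) (x : Q) : space M x ⟶ space N x :=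
  f.app ((Paths.of Q).obj x)

/-- The linear map `M(p)` along a path `p`. -/
def pathMap (M : Repr k Q) {x y : Q} (p : Quiver.Path x y) : space M x ⟶ space M y :=
  M.map (X := (Paths.of Q).obj x) (Y := (Paths.of Q).obj y) p

theorem pathMap_nil (M : Repr k Q) (x : Q) : pathMap M (Quiver.Path.nil : Quiver.Path x x) = 𝟙 _ :=
  M.map_id _

theorem pathMap_comp (M : Repr k Q) {x y z : Q} (p : Quiver.Path x y) (q : Quiver.Path y z) :
    pathMap M (p.comp q) = pathMap M p ≫ pathMap M q :=
  M.map_comp (X := (Paths.of Q).obj x) (Y := (Paths.of Q).obj y) (Z := (Paths.of Q).obj z) p q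

theorem pathMap_cons (M : Repr k Q) {x y z : Q} (p : Quiver.Path x y) (α : y ⟶ z) :
    pathMap M (p.cons α) = pathMap M p ≫ arrowMap M α :=
  pathMap_comp M p α.toPath

theorem vmap_naturality {M N : Repr k Q} (f : M ⟶ N) {x y : Q} (α : x ⟶ y) :
    arrowMap M α ≫ vmap f y = vmap f x ≫ arrowMap N α :=
  f.naturality _

theorem vmap_pathMap {M N : Repr k Q} (f : M ⟶ N) {x y : Q} (p : Quiver.Path x y) :
    pathMap M p ≫ vmap f y = vmap f x ≫ pathMap N p :=
  f.naturality (X := (Paths.of Q).obj x) (Y := (Paths.of Q).obj y) p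

theorem vmap_comp {M N K : Repr k Q} (f : M ⟶ N) (g : N ⟶ K) (x : Q) :
    vmap (f ≫ g) x = vmap f x ≫ vmap g x := rfl

theorem vmap_id (M : Repr k Q) (x : Q) : vmap (𝟙 M) x = 𝟙 _ := rfl

theorem vmap_zero (M N : Repr k Q) (x : Q) : vmap (0 : M ⟶ N) x = 0 := rfl

theorem hom_ext_vmap {M N : Repr k Q} {f g : M ⟶ N} (h : ∀ x, vmap f x = vmap g x) : f = g :=
  NatTrans.ext (funext h)

/-- A family of linear maps compatible with the arrows is a morphism of representations. -/
def homMk {M N : Repr k Q} (φ : ∀ x, space M x ⟶ space N x)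
    (h : ∀ (x y : Q) (α : x ⟶ y), arrowMap M α ≫ φ y = φ x ≫ arrowMap N α) : M ⟶ N where
  app := φ
  naturality := by
    have key : ∀ {a : Q} {b : Q} (p : Quiver.Path a b),
        pathMap M p ≫ φ b = φ a ≫ pathMap N p := by
      intro a b p
      induction p with
      | nil => rw [pathMap_nil, pathMap_nil, Category.id_comp, Category.comp_id]
      | cons p α ih =>
        rw [pathMap_cons, pathMap_cons, Category.assoc, h, ← Category.assoc, ih, Category.assoc]
    intro a b p
    exact key (a := a) (b := b) p

theorem vmap_homMk {M N : Repr k Q} (φ : ∀ x, space M x ⟶ space N x)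
    (h : ∀ (x y : Q) (α : x ⟶ y), arrowMap M α ≫ φ y = φ x ≫ arrowMap N α) (x : Q) :
    vmap (homMk φ h) x = φ x := rfl

theorem not_mem_supp_iff {M : Repr k Q} {x : Q} : x ∉ supp M ↔ IsZero (space M x) := by
  rw [ModuleCat.isZero_iff_subsingleton]
  exact not_nontrivial_iff_subsingleton

theorem isZero_of_supp_eq_empty {M : Repr k Q} (h : supp M = ∅) : IsZero M := by
  rw [IsZero.iff_id_eq_zero]
  refine hom_ext_vmap fun x => (not_mem_supp_iff.1 ?_).eq_of_src _ _
  rw [h]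
  exact Set.notMem_empty x

theorem supp_eq_empty_of_isZero {M : Repr k Q} (h : IsZero M) : supp M = ∅ := by
  refine Set.eq_empty_of_forall_notMem fun x => not_mem_supp_iff.2 ?_
  rw [IsZero.iff_id_eq_zero] at h ⊢
  exact congrArg (fun f => vmap f x) h

/-! ## Restriction -/

theorem isZero_restrict_space (M : Repr k Q) {S : Set Q} {x : Q} (hx : x ∉ S) :
    IsZero (space (restrict M S) x) := by
  rw [ModuleCat.isZero_iff_subsingleton]
  exact ⟨fun a b => Subtype.ext ((a.2 hx).trans (b.2 hx).symm)⟩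

/-- The inclusion of `M_S(x)` into `M(x)`. -/
def resIncl (M : Repr k Q) (S : Set Q) (x : Q) : space (restrict M S) x ⟶ space M x :=
  ModuleCat.ofHom (restrictSpace M S x).subtype

open Classical in
/-- The projection of `M(x)` onto `M_S(x)`. -/
def resProj (M : Repr k Q) (S : Set Q) (x : Q) : space M x ⟶ space (restrict M S) x :=
  if hx : x ∈ S then
    ModuleCat.ofHom (LinearMap.codRestrict (restrictSpace M S x) LinearMap.id
      (fun _ h => absurd hx h))
  else 0

theorem resProj_of_mem (M : Repr k Q) {S : Set Q} {x : Q} (hx : x ∈ S) :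
    resProj M S x = ModuleCat.ofHom (LinearMap.codRestrict (restrictSpace M S x) LinearMap.id
      (fun _ h => absurd hx h)) :=
  dif_pos hx

theorem restrictMap_of_mem (M : Repr k Q) {S : Set Q} {x y : Q} (α : x ⟶ y) (hy : y ∈ S) :
    restrictMap M S α = ((arrowMap M α).hom.comp (restrictSpace M S x).subtype).codRestrict
      (restrictSpace M S y) (fun _ h => absurd hy h) :=
  dif_pos hy

theorem resProj_resIncl (M : Repr k Q) {S : Set Q} {x : Q} (hx : x ∈ S) :
    resProj M S x ≫ resIncl M S x = 𝟙 _ := by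
  rw [resProj_of_mem M hx]
  rfl

theorem resIncl_resProj (M : Repr k Q) (S : Set Q) (x : Q) :
    resIncl M S x ≫ resProj M S x = 𝟙 _ := by
  by_cases hx : x ∈ S
  · rw [resProj_of_mem M hx]
    rfl
  · exact (isZero_restrict_space M hx).eq_of_src _ _

theorem arrowMap_restrict (M : Repr k Q) (S : Set Q) {x y : Q} (α : x ⟶ y) :
    arrowMap (restrict M S) α = resIncl M S x ≫ arrowMap M α ≫ resProj M S y := by
  have h : arrowMap (restrict M S) α = ModuleCat.ofHom (restrictMap M S α) :=
    Paths.lift_toPath _ α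
  rw [h]
  by_cases hy : y ∈ S
  · rw [restrictMap_of_mem M α hy, resProj_of_mem M hy]
    rfl
  · exact (isZero_restrict_space M hy).eq_of_tgt _ _

theorem supp_restrict (M : Repr k Q) (S : Set Q) : supp (restrict M S) = supp M ∩ S := by
  ext x
  by_cases hx : x ∈ S
  · have e : space (restrict M S) x ≅ space M x :=
      ⟨resIncl M S x, resProj M S x, resIncl_resProj M S x, resProj_resIncl M hx⟩
    have := not_congr e.isZero_iff
    rw [← not_mem_supp_iff, ← not_mem_supp_iff, not_not, not_not] at this
    simp [this, hx]
  · simp [hx, not_mem_supp_iff.2 (isZero_restrict_space M hx)]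

/-! ## Indecomposability and idempotents -/

/-- In an abelian category `e` and `1 - e` both split, and their images decompose `X`; conversely a
decomposition yields the idempotent projecting to its first summand. In this form indecomposability
depends only on the endomorphism ring, apart from `X ≠ 0`. -/
theorem indecomposable_iff_idempotent {C : Type*} [Category* C] [Abelian C] (X : C) :
    Indecomposable X ↔ ¬ IsZero X ∧ ∀ e : X ⟶ X, e ≫ e = e → e = 0 ∨ e = 𝟙 X := by
  refine and_congr_right fun _ => ⟨fun h e he => ?_, fun h Y Z φ => ?_⟩
  · obtain ⟨Y, i, p, hip, hpi⟩ := IsIdempotentComplete.idempotents_split X e he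
    obtain ⟨Z, j, q, hjq, hqj⟩ := IsIdempotentComplete.idempotents_split X (𝟙 X - e)
      (Idempotents.idem_of_id_sub_idem e he)
    have hiq : i ≫ q = 0 := by
      have : i ≫ (q ≫ j) ≫ q = 0 := by
        rw [hqj, ← hpi, Preadditive.sub_comp, Preadditive.comp_sub, Category.id_comp,
          Category.assoc, ← Category.assoc i p, hip, Category.id_comp, sub_self]
      simpa [hjq] using this
    have hjp : j ≫ p = 0 := by
      have : j ≫ (p ≫ i) ≫ p = 0 := by
        have hpi' : p ≫ i = 𝟙 X - q ≫ j := by rw [hpi, hqj, sub_sub_cancel]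
        rw [hpi', Preadditive.sub_comp, Preadditive.comp_sub, Category.id_comp,
          Category.assoc, ← Category.assoc j q, hjq, Category.id_comp, sub_self]
      simpa [hip] using this
    let φ : X ≅ Y ⊞ Z :=
      { hom := biprod.lift p q
        inv := biprod.desc i j
        hom_inv_id := by rw [biprod.lift_desc, hpi, hqj, add_sub_cancel]
        inv_hom_id := by
          ext <;> simp [hip, hjq, hiq, hjp] }
    rcases h Y Z φ with hY | hZ
    · left
      rw [← hpi, hY.eq_of_tgt p 0, zero_comp]
    · right
      rw [hZ.eq_of_tgt q 0, zero_comp] at hqj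
      exact (sub_eq_zero.1 hqj.symm).symm
  · rcases h (φ.hom ≫ biprod.fst ≫ biprod.inl ≫ φ.inv) (by simp) with h | h
    · left
      rw [IsZero.iff_id_eq_zero]
      have := congrArg (fun f => biprod.inl ≫ φ.inv ≫ f ≫ φ.hom ≫ biprod.fst) h
      simpa using this
    · right
      rw [IsZero.iff_id_eq_zero]
      have := congrArg (fun f => biprod.inr ≫ φ.inv ≫ f ≫ φ.hom ≫ biprod.snd) h
      simpa using this.symm

/-! ## Representations that are free on a successor-closed set of vertices -/

/-- `M(y)` is, via the maps `M(α)`, the direct sum of the `M(z)` over all arrows `α : z ⟶ y` with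
`z ∈ U`, and `M(α) = 0` for all other arrows ending in `y`. -/
def RelFree (M : Repr k Q) (U : Set Q) (y : Q) : Prop :=
  (∀ (z : Q) (α : z ⟶ y), z ∉ U → arrowMap M α = 0) ∧
    ∀ (W : ModuleCat.{max u v w} k) (h : ∀ z : Q, (z ⟶ y) → (space M z ⟶ W)),
      ∃! g : space M y ⟶ W, ∀ (z : Q) (α : z ⟶ y), z ∈ U → arrowMap M α ≫ g = h z α

/-- A co-finite part `SP` of the support of `M` inside `U` which is closed under successors, and on
which `M` is free. -/
structure IsFreePart (M : Repr k Q) (U SP : Set Q) : Prop where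
  subset : SP ⊆ U
  subset_supp : SP ⊆ supp M
  closed : ∀ ⦃x y : Q⦄, (x ⟶ y) → x ∈ SP → y ∈ SP
  free : ∀ y ∈ SP, RelFree M U y
  rank : ∃ r : Q → ℕ, ∀ z ∈ U, ∀ y ∈ U, (z ⟶ y) → r z < r y
  finite : ((supp M ∩ U) \ SP).Finite

theorem Reach.mem_of_closed {S T : Set Q} (hT : ∀ ⦃x y : Q⦄, (x ⟶ y) → x ∈ T → y ∈ T) {x y : Q}
    (h : Reach S x y) (hx : x ∈ T) : y ∈ T := by
  obtain ⟨-, h⟩ := h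
  induction h with
  | refl => exact hx
  | tail _ h ih => exact hT h.2.some ih

namespace IsFreePart

variable {M : Repr k Q} {U SP : Set Q}

/-- Freeness and the rank refer to `U`, not to `SP`, so they survive shrinking. An arrow of `Q` out
of `SP'` stays in `SP`, hence is a path of `SP`, to which closedness of `SP'` applies. -/
theorem mono (h : IsFreePart M U SP) {SP' : Set Q} (hc : CofiniteIn SP' SP)
    (hs : SuccessorClosedIn SP' SP) : IsFreePart M U SP' where
  subset := hc.1.trans h.subset
  subset_supp := hc.1.trans h.subset_supp
  closed x y α hx := by
    have hy := h.closed α (hc.1 hx)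
    exact hs.2 x y ⟨hc.1 hx, .single ⟨hy, ⟨α⟩⟩⟩ hx
  free y hy := h.free y (hc.1 hy)
  rank := h.rank
  finite := (h.finite.union hc.2).subset fun x hx => by
    by_cases hx' : x ∈ SP
    · exact Or.inr ⟨hx', hx.2⟩
    · exact Or.inl ⟨hx.1, hx'⟩

theorem successorClosedIn (h : IsFreePart M U SP) : SuccessorClosedIn SP (supp M) :=
  ⟨h.subset_supp, fun _ _ hxy hx => hxy.mem_of_closed h.closed hx⟩

open Classical in
/-- A family of linear maps on `SP`, defined by recursion along the arrows. -/
def extend (h : IsFreePart M U SP) (X : Repr k Q)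
    (g : ∀ z y : Q, (z ⟶ y) → (space M z ⟶ space X y)) (y : Q) : space M y ⟶ space X y :=
  if hy : y ∈ SP then
    ((h.free y hy).2 (space X y) (fun z α =>
      -- Inside `SP` the value is forced by naturality from the map at `z`, which has smaller rank;
      -- on arrows entering from outside it is the free datum `g`.
      if hz : z ∈ SP then
        have : h.rank.choose z < h.rank.choose y :=
          h.rank.choose_spec z (h.subset hz) y (h.subset hy) α
        extend h X g z ≫ arrowMap X α
      else g z y α)).choose
  else 0
termination_by h.rank.choose y

open Classical in
theorem arrowMap_extend (h : IsFreePart M U SP) (X : Repr k Q)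
    (g : ∀ z y : Q, (z ⟶ y) → (space M z ⟶ space X y)) {y z : Q} (α : z ⟶ y)
    (hy : y ∈ SP) (hz : z ∈ U) :
    arrowMap M α ≫ h.extend X g y =
      if z ∈ SP then h.extend X g z ≫ arrowMap X α else g z y α := by
  have e : h.extend X g y = ((h.free y hy).2 (space X y) (fun z α =>
      if z ∈ SP then h.extend X g z ≫ arrowMap X α else g z y α)).choose := by
    rw [extend]
    exact dif_pos hy
  rw [e]
  exact ((h.free y hy).2 (space X y) (fun z α =>
      if z ∈ SP then h.extend X g z ≫ arrowMap X α else g z y α)).choose_spec.1 z α hz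

/-- Induction on the rank, using the uniqueness half of freeness. Arrows from outside `U` impose no
condition there, so agreement on the arrows from `U \ SP` suffices. -/
theorem family_ext (h : IsFreePart M U SP) {X : Repr k Q} {φ ψ : ∀ x : Q, space M x ⟶ space X x}
    (hφ : ∀ ⦃x y : Q⦄ (α : x ⟶ y), x ∈ SP → arrowMap M α ≫ φ y = φ x ≫ arrowMap X α)
    (hψ : ∀ ⦃x y : Q⦄ (α : x ⟶ y), x ∈ SP → arrowMap M α ≫ ψ y = ψ x ≫ arrowMap X α)
    (he : ∀ ⦃x y : Q⦄ (α : x ⟶ y), x ∈ U → x ∉ SP → y ∈ SP →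
      arrowMap M α ≫ φ y = arrowMap M α ≫ ψ y) {x : Q} (hx : x ∈ SP) : φ x = ψ x := by
  obtain ⟨r, hr⟩ := h.rank
  induction hn : r x using Nat.strong_induction_on generalizing x with
  | _ n ih =>
    refine ((h.free x hx).2 (space X x) (fun z α => arrowMap M α ≫ ψ x)).unique
      (fun z α hz => ?_) (fun _ _ _ => rfl)
    by_cases hz' : z ∈ SP
    · rw [hφ α hz', hψ α hz', ih (r z) (hn ▸ hr z hz x (h.subset hx) α) hz' rfl]
    · exact he α hz hz' hx

/-- Otherwise `M(y)` would be a direct sum of zero spaces, although `y` lies in the support. -/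
theorem exists_arrow (h : IsFreePart M U SP) {y : Q} (hy : y ∈ SP) :
    ∃ z ∈ supp M ∩ U, Nonempty (z ⟶ y) := by
  by_contra! hc
  refine not_mem_supp_iff.2 ?_ (h.subset_supp hy)
  rw [IsZero.iff_id_eq_zero]
  refine ((h.free y hy).2 (space M y) (fun z α => 0)).unique (fun z α hz => ?_)
    (fun _ _ _ => comp_zero)
  refine (not_mem_supp_iff.1 fun hz' => ?_).eq_of_src _ _
  exact (hc z ⟨hz', hz⟩).false α

theorem finite_entering (hQ : StronglyLocallyFinite Q) (h : IsFreePart M U SP) :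
    {e : Σ (x : Q) (y : Q), (x ⟶ y) | e.1 ∈ (supp M ∩ U) \ SP ∧ e.2.1 ∈ SP}.Finite := by
  refine (h.finite.biUnion fun x _ =>
    @Set.finite_range _ _ (fun e : Σ y : Q, (x ⟶ y) => (⟨x, e⟩ : Σ (x : Q) (y : Q), (x ⟶ y)))
      (hQ.finite_out x)).subset ?_
  rintro ⟨x, e⟩ hx
  exact Set.mem_biUnion hx.1 ⟨e, rfl⟩

/-- A source of `SP` still receives an arrow from the support within `U`, so it is the target of one
of the finitely many entering arrows. Going backwards inside `SP` lowers the rank and must stop at a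
source. -/
theorem topFinite (hQ : StronglyLocallyFinite Q) (h : IsFreePart M U SP) : TopFinite SP := by
  constructor
  · refine ((h.finite_entering hQ).image (fun e => e.2.1)).subset ?_
    rintro y ⟨hy, hy'⟩
    obtain ⟨z, hz, ⟨α⟩⟩ := h.exists_arrow hy
    exact ⟨⟨z, y, α⟩, ⟨⟨hz, fun hz' => (hy' z hz').false α⟩, hy⟩, rfl⟩
  · obtain ⟨r, hr⟩ := h.rank
    intro x hx
    induction hn : r x using Nat.strong_induction_on generalizing x with
    | _ n ih =>
      by_cases hs : IsSourceIn SP x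
      · exact ⟨x, hs, hx, .refl⟩
      · obtain ⟨z, hz, ⟨α⟩⟩ : ∃ z ∈ SP, Nonempty (z ⟶ x) := by
          by_contra! hc
          exact hs ⟨hx, hc⟩
        obtain ⟨s, hs, hs'⟩ := ih (r z) (hn ▸ hr z (h.subset hz) x (h.subset hx) α) z hz rfl
        exact ⟨s, hs, hs'.1, hs'.2.tail ⟨hx, ⟨α⟩⟩⟩

end IsFreePart

/-! ## The representations `P_a` -/

/-- The basis element of `P_a(x)` given by a path `p` from `a` to `x`. -/
def pathElt (k : Type u) [Field k] {a x : Q} (p : Quiver.Path a x) : space (projRep k Q a) x :=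
  Finsupp.single p (1 : k)

theorem projRep_lhom_ext {a x : Q} {W : ModuleCat.{max u v w} k}
    {f g : space (projRep k Q a) x ⟶ W}
    (h : ∀ p : Quiver.Path a x, f.hom (pathElt k p) = g.hom (pathElt k p)) : f = g :=
  ModuleCat.hom_ext (Finsupp.lhom_ext' fun p => LinearMap.ext_ring (h p))

/-- The linear map on `P_a(x)` with given values on the paths. -/
def projLift {a x : Q} {W : ModuleCat.{max u v w} k} (m : Quiver.Path a x → W) :
    space (projRep k Q a) x ⟶ W :=
  ModuleCat.ofHom (Finsupp.lsum k (fun p : Quiver.Path a x => LinearMap.toSpanSingleton k W (m p)))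

theorem projLift_pathElt {a x : Q} {W : ModuleCat.{max u v w} k} (m : Quiver.Path a x → W)
    (p : Quiver.Path a x) : (projLift m).hom (pathElt k p) = m p :=
  (Finsupp.lsum_single k _ p (1 : k)).trans (one_smul k _)

theorem hom_comp_apply {A B C : ModuleCat.{t} k} (f : A ⟶ B) (g : B ⟶ C) (m : A) :
    (f ≫ g).hom m = g.hom (f.hom m) := rfl

theorem arrowMap_pathElt {a x y : Q} (p : Quiver.Path a x) (α : x ⟶ y) :
    (arrowMap (projRep k Q a) α).hom (pathElt k p) = pathElt k (p.cons α) := by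
  have : arrowMap (projRep k Q a) α =
      ModuleCat.ofHom (Finsupp.lmapDomain k k (fun p : Quiver.Path a x => p.cons α)) :=
    Paths.lift_toPath _ α
  rw [this]
  exact Finsupp.mapDomain_single

theorem pathMap_pathElt {a x : Q} (p : Quiver.Path a x) :
    (pathMap (projRep k Q a) p).hom (pathElt k Quiver.Path.nil) = pathElt k p := by
  induction p with
  | nil => rw [pathMap_nil]; rfl
  | cons p α ih => rw [pathMap_cons, hom_comp_apply, ih, arrowMap_pathElt]

theorem projRep_hom_ext {a : Q} {X : Repr k Q} {f g : projRep k Q a ⟶ X}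
    (h : (vmap f a).hom (pathElt k .nil) = (vmap g a).hom (pathElt k .nil)) : f = g := by
  refine hom_ext_vmap fun x => projRep_lhom_ext fun p => ?_
  rw [← pathMap_pathElt, ← hom_comp_apply, ← hom_comp_apply, vmap_pathMap, vmap_pathMap,
    hom_comp_apply, hom_comp_apply, h]

/-- The morphism `P_a ⟶ X` that sends the generator to a given element of `X(a)`. -/
def projDesc {a : Q} (X : Repr k Q) (m : space X a) : projRep k Q a ⟶ X :=
  homMk (fun _ => projLift fun p => (pathMap X p).hom m) (fun x y α => projRep_lhom_ext fun p => by
    rw [hom_comp_apply, hom_comp_apply, projLift_pathElt, arrowMap_pathElt, projLift_pathElt,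
      pathMap_cons, hom_comp_apply])

theorem projDesc_nil {a : Q} (X : Repr k Q) (m : space X a) :
    (vmap (projDesc X m) a).hom (pathElt k .nil) = m :=
  (projLift_pathElt (a := a) (x := a) _ _).trans
    (congrArg (fun φ => φ.hom m) (pathMap_nil X a))

/-- Yoneda: morphisms `P_a ⟶ X` are elements of `X(a)`, and these lift along epimorphisms, which are
surjective at `a`. -/
instance projective_projRep (a : Q) : Projective (projRep k Q a) where
  factors {E X} f e _ := by
    obtain ⟨m, hm⟩ := (ModuleCat.epi_iff_surjective (vmap e a)).1 inferInstance
      ((vmap f a).hom (pathElt k .nil))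
    refine ⟨projDesc E m, projRep_hom_ext ?_⟩
    rw [vmap_comp, hom_comp_apply, projDesc_nil]
    exact hm

/-! ## Projective objects of `rep⁺(Q)` -/

instance projective_biproduct_projRep {ι : Type*} [Finite ι] (x : ι → Q) :
    Projective (⨁ fun i => projRep k Q (x i)) where
  factors f e _ :=
    ⟨biproduct.desc fun i => Projective.factorThru (biproduct.ι (fun i => projRep k Q (x i)) i ≫ f) e,
      biproduct.hom_ext' _ _ fun i => by simp⟩

theorem repPlus_of_finite {ι κ : Type*} [Finite ι] [Finite κ] {x : ι → Q} {y : κ → Q}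
    {M : Repr k Q} (f : (⨁ fun i => projRep k Q (x i)) ⟶ ⨁ fun j => projRep k Q (y j))
    (g : (⨁ fun j => projRep k Q (y j)) ⟶ M) (h : f ≫ g = 0)
    (hex : (ShortComplex.mk f g h).Exact) (hg : Epi g) : repPlus k Q M := by
  obtain ⟨m, ⟨e⟩⟩ := Finite.exists_equiv_fin ι
  obtain ⟨n, ⟨e'⟩⟩ := Finite.exists_equiv_fin κ
  let φ : (⨁ fun i => projRep k Q (x i)) ≅ ⨁ fun i => projRep k Q (x (e.symm i)) :=
    biproduct.whiskerEquiv e fun j => eqToIso (by simp)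
  let ψ : (⨁ fun i => projRep k Q (y i)) ≅ ⨁ fun i => projRep k Q (y (e'.symm i)) :=
    biproduct.whiskerEquiv e' fun j => eqToIso (by simp)
  refine ⟨m, n, _, _, φ.inv ≫ f ≫ ψ.hom, ψ.inv ≫ g, by simp [h], ?_, epi_comp _ _⟩
  let T := ShortComplex.mk (φ.inv ≫ f ≫ ψ.hom) (ψ.inv ≫ g) (by simp [h])
  let e : ShortComplex.mk f g h ≅ T :=
    ShortComplex.isoMk φ ψ (Iso.refl _) (by simp [T]) (by simp [T])
  exact ShortComplex.exact_of_iso e hex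

/-- Closure of `rep⁺(Q)` under cokernels: `C` has the generators of `B`; its relations are those of
`B` together with lifts of the images of the generators of `A`. -/
theorem repPlus_of_exact {A B C : Repr k Q} (hA : repPlus k Q A) (hB : repPlus k Q B)
    (f : A ⟶ B) (c : B ⟶ C) (h : f ≫ c = 0) (hex : (ShortComplex.mk f c h).Exact) (hc : Epi c) :
    repPlus k Q C := by
  obtain ⟨-, n, -, y, -, gA, -, -, hgA⟩ := hA
  obtain ⟨m', n', x', y', fB, gB, hB, hBex, hgB⟩ := hB
  let l := Projective.factorThru (gA ≫ f) gB
  have hl : l ≫ gB = gA ≫ f := Projective.factorThru_comp _ _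
  let d : (⨁ fun s : Fin m' ⊕ Fin n => projRep k Q (Sum.elim x' y s)) ⟶
      ⨁ fun j => projRep k Q (y' j) :=
    biproduct.desc fun s => match s with
      | .inl i => biproduct.ι (fun i => projRep k Q (x' i)) i ≫ fB
      | .inr j => biproduct.ι (fun j => projRep k Q (y j)) j ≫ l
  have hd1 (i) {T : Repr k Q} (t : (⨁ fun j => projRep k Q (y' j)) ⟶ T) :
      biproduct.ι (fun s : Fin m' ⊕ Fin n => projRep k Q (Sum.elim x' y s)) (.inl i) ≫ d ≫ t =
        biproduct.ι (fun i => projRep k Q (x' i)) i ≫ fB ≫ t :=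
    (biproduct.ι_desc_assoc _ _ _).trans (Category.assoc _ _ _)
  have hd2 (i) {T : Repr k Q} (t : (⨁ fun j => projRep k Q (y' j)) ⟶ T) :
      biproduct.ι (fun s : Fin m' ⊕ Fin n => projRep k Q (Sum.elim x' y s)) (.inr i) ≫ d ≫ t =
        biproduct.ι (fun i => projRep k Q (y i)) i ≫ l ≫ t :=
    (biproduct.ι_desc_assoc _ _ _).trans (Category.assoc _ _ _)
  have hd : ∀ {T : Repr k Q} (t : (⨁ fun j => projRep k Q (y' j)) ⟶ T),
      d ≫ t = 0 ↔ fB ≫ t = 0 ∧ l ≫ t = 0 := by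
    intro T t
    constructor
    · intro ht
      constructor
      · refine biproduct.hom_ext' _ _ fun i => ?_
        rw [← hd1, ht, comp_zero, comp_zero]
        rfl
      · refine biproduct.hom_ext' _ _ fun i => ?_
        rw [← hd2, ht, comp_zero, comp_zero]
        rfl
    · rintro ⟨h1, h2⟩
      refine biproduct.hom_ext' _ _ fun i => ?_
      rcases i with i | i
      · rw [hd1, h1, comp_zero, comp_zero]
        rfl
      · rw [hd2, h2, comp_zero, comp_zero]
        rfl
  have w : d ≫ gB ≫ c = 0 := by
    rw [hd, ← Category.assoc, hB, zero_comp, ← Category.assoc, hl, Category.assoc, h, comp_zero]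
    exact ⟨rfl, rfl⟩
  -- This is the existence half of the statement that `gB ≫ c` is a cokernel of `d`.
  have key : ∀ {T : Repr k Q} (t : (⨁ fun j => projRep k Q (y' j)) ⟶ T), d ≫ t = 0 →
      ∃ s : C ⟶ T, (gB ≫ c) ≫ s = t := by
    intro T t ht
    rw [hd] at ht
    obtain ⟨s, hs⟩ : ∃ s : B ⟶ T, gB ≫ s = t := ⟨hBex.desc t ht.1, hBex.g_desc t ht.1⟩
    have hfs : f ≫ s = 0 := by
      rw [← cancel_epi gA, ← Category.assoc, ← hl, Category.assoc, hs, ht.2, comp_zero]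
    refine ⟨hex.desc s hfs, ?_⟩
    rw [Category.assoc]
    exact (congrArg (gB ≫ ·) (hex.g_desc s hfs)).trans hs
  refine repPlus_of_finite d (gB ≫ c) w ?_ (epi_comp _ _)
  refine ShortComplex.exact_of_g_is_cokernel _ (CokernelCofork.IsColimit.ofπ _ w
    (fun t ht => (key t ht).choose) (fun t ht => (key t ht).choose_spec) fun t ht s hs => ?_)
  rw [← cancel_epi (gB ≫ c), (key t ht).choose_spec, hs]

/-- The cokernel taken in `Rep(Q)` lies in `rep⁺(Q)`, so it is already tested there. Hence objects
of `rep⁺(Q)` that are projective in `Rep(Q)` are projective in `rep⁺(Q)`. -/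
theorem epi_of_epi_repPlus {A B : (repPlus k Q).FullSubcategory} (f : A ⟶ B) [Epi f] :
    Epi f.hom := by
  have hC : repPlus k Q (cokernel f.hom) :=
    repPlus_of_exact A.property B.property f.hom (cokernel.π f.hom) (cokernel.condition _)
      (ShortComplex.exact_cokernel _) inferInstance
  refine Preadditive.epi_of_cokernel_zero ?_
  let c : B ⟶ ⟨cokernel f.hom, hC⟩ := ObjectProperty.homMk (cokernel.π f.hom)
  have : c = ObjectProperty.homMk 0 := by
    rw [← cancel_epi f]
    ext1
    simp [c]
  exact congrArg (fun φ => φ.hom) this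

theorem isProjective_of_iso {ι : Type*} [Finite ι] {x : ι → Q} {M : Repr k Q}
    (e : (⨁ fun i => projRep k Q (x i)) ≅ M) : IsProjective M := by
  have hM : repPlus k Q M := by
    refine repPlus_of_finite (ι := Fin 0) (x := Fin.elim0) 0 e.hom zero_comp ?_ inferInstance
    exact (ShortComplex.exact_iff_mono _ rfl).2 inferInstance
  have : Projective M := Projective.of_iso e inferInstance
  refine ⟨hM, ⟨fun {E X} f g _ => ?_⟩⟩
  have := epi_of_epi_repPlus g
  exact ⟨ObjectProperty.homMk (Projective.factorThru f.hom g.hom), by ext1; simp⟩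

theorem isProjective_of_isZero {M : Repr k Q} (hM : IsZero M) : IsProjective M :=
  isProjective_of_iso (ι := Fin 0) (x := Fin.elim0)
    ((IsZero.iff_id_eq_zero _).2 (biproduct.hom_ext _ _ fun i => i.elim0) |>.iso hM)

namespace IsFreePart

variable {M : Repr k Q} {U SP : Set Q}

/-- Each entering arrow `x ⟶ y` contributes `dim M(x)` copies of `P_y`: the generator indexed by a
basis vector of `M(x)` goes to the image of that vector in `M(y)`. -/
theorem isProjective (hQ : StronglyLocallyFinite Q) (hM : LocallyFiniteDimensional M)
    (h : IsFreePart M U SP) : IsProjective (restrict M SP) := by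
  classical
  let E := {e : Σ (x : Q) (y : Q), (x ⟶ y) // e.1 ∈ (supp M ∩ U) \ SP ∧ e.2.1 ∈ SP}
  have : Finite E := h.finite_entering hQ
  have hfd : ∀ x, FiniteDimensional k (space M x) := hM
  let I := Σ e : E, Fin (Module.finrank k (space M e.1.1))
  let b (x : Q) := Module.finBasis k (space M x)
  let P : Repr k Q := ⨁ fun i : I => projRep k Q i.1.1.2.1
  let ι (i : I) : projRep k Q i.1.1.2.1 ⟶ P := biproduct.ι (fun i : I => projRep k Q i.1.1.2.1) i
  let R := restrict M SP
  let Φ : P ⟶ R := biproduct.desc fun i : I =>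
    projDesc R ((arrowMap M i.1.1.2.2 ≫ resProj M SP i.1.1.2.1).hom (b i.1.1.1 i.2))
  have hΦ (i : I) : (vmap Φ i.1.1.2.1).hom ((vmap (ι i) i.1.1.2.1).hom (pathElt k .nil)) =
      (arrowMap M i.1.1.2.2 ≫ resProj M SP i.1.1.2.1).hom (b i.1.1.1 i.2) := by
    rw [← hom_comp_apply, ← vmap_comp, biproduct.ι_desc, projDesc_nil]
  -- The data for the inverse: on an entering arrow, basis vectors go back to the corresponding
  -- generators, and freeness extends this over `SP`.
  let g (z y : Q) (α : z ⟶ y) : space M z ⟶ space P y :=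
    if he : z ∈ (supp M ∩ U) \ SP ∧ y ∈ SP then
      ModuleCat.ofHom ((b z).constr k fun j =>
        (vmap (ι ⟨⟨⟨z, y, α⟩, he⟩, j⟩) y).hom (pathElt k .nil))
    else 0
  have hg (z y : Q) (α : z ⟶ y) (he : z ∈ (supp M ∩ U) \ SP ∧ y ∈ SP) j :
      (g z y α).hom (b z j) = (vmap (ι ⟨⟨⟨z, y, α⟩, he⟩, j⟩) y).hom (pathElt k .nil) := by
    have : g z y α = ModuleCat.ofHom ((b z).constr k fun j =>
        (vmap (ι ⟨⟨⟨z, y, α⟩, he⟩, j⟩) y).hom (pathElt k .nil)) := dif_pos he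
    rw [this]
    exact (b z).constr_basis k _ j
  have hin {x y : Q} (α : x ⟶ y) (hx : x ∈ SP) :
      arrowMap M α ≫ h.extend P g y = h.extend P g x ≫ arrowMap P α := by
    rw [h.arrowMap_extend P g α (h.closed α hx) (h.subset hx), if_pos hx]
  have hout {x y : Q} (α : x ⟶ y) (hxU : x ∈ U) (hx : x ∉ SP) (hy : y ∈ SP) :
      arrowMap M α ≫ h.extend P g y = g x y α := by
    rw [h.arrowMap_extend P g α hy hxU, if_neg hx]
  let Ψ : R ⟶ P := homMk (fun x => resIncl M SP x ≫ h.extend P g x) fun x y α => by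
    by_cases hx : x ∈ SP
    · rw [arrowMap_restrict]
      simp only [Category.assoc]
      rw [← Category.assoc (resProj M SP y), resProj_resIncl M (h.closed α hx), Category.id_comp,
        hin α hx]
    · exact (isZero_restrict_space M hx).eq_of_src _ _
  -- Both families agree on the basis vectors entering `SP`, hence on all of `SP` by `family_ext`.
  have h1 {x : Q} (hx : x ∈ SP) : h.extend P g x ≫ vmap Φ x = resProj M SP x := by
    refine h.family_ext (X := R) (φ := fun x => h.extend P g x ≫ vmap Φ x) (ψ := resProj M SP)
      (fun x y α hx => ?_) (fun x y α hx => ?_) (fun x y α hxU hx hy => ?_) hx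
    · rw [← Category.assoc, hin α hx, Category.assoc, Category.assoc, vmap_naturality]
    · rw [arrowMap_restrict, ← Category.assoc (resProj M SP x), resProj_resIncl M hx,
        Category.id_comp]
    · rw [← Category.assoc, hout α hxU hx hy]
      by_cases hxs : x ∈ supp M
      · refine ModuleCat.hom_ext ((b x).ext fun j => ?_)
        have he : x ∈ (supp M ∩ U) \ SP ∧ y ∈ SP := ⟨⟨⟨hxs, hxU⟩, hx⟩, hy⟩
        rw [hom_comp_apply, hg x y α he]
        exact hΦ ⟨⟨⟨x, y, α⟩, he⟩, j⟩
      · exact (not_mem_supp_iff.1 hxs).eq_of_src _ _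
  refine isProjective_of_iso (ι := I) (x := fun i => i.1.1.2.1) (M := R) ⟨Φ, Ψ, ?_, ?_⟩
  · refine biproduct.hom_ext' _ _ fun i => projRep_hom_ext ?_
    rw [Category.comp_id, vmap_comp, vmap_comp, hom_comp_apply, hom_comp_apply]
    refine (congrArg _ (hΦ i)).trans ?_
    rw [vmap_homMk, ← hom_comp_apply, ← Category.assoc, Category.assoc (arrowMap M _),
      resProj_resIncl M i.1.2.2, Category.comp_id,
      hout i.1.1.2.2 i.1.2.1.1.2 i.1.2.1.2 i.1.2.2]
    exact hg _ _ _ i.1.2 i.2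
  · refine hom_ext_vmap fun x => ?_
    by_cases hx : x ∈ SP
    · rw [vmap_comp, vmap_homMk, Category.assoc, h1 hx, resIncl_resProj, vmap_id]
    · exact (isZero_restrict_space M hx).eq_of_src _ _

end IsFreePart

/-! ## Representations that are cofree on a predecessor-closed set of vertices -/

/-- `M(y)` is, via the maps `M(α)`, the product of the `M(z)` over all arrows `α : y ⟶ z` with
`z ∈ V`, and `M(α) = 0` for all other arrows starting in `y`. -/
def RelCofree (M : Repr k Q) (V : Set Q) (y : Q) : Prop :=
  (∀ (z : Q) (α : y ⟶ z), z ∉ V → arrowMap M α = 0) ∧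
    ∀ (W : ModuleCat.{max u v w} k) (h : ∀ z : Q, (y ⟶ z) → (W ⟶ space M z)),
      ∃! g : W ⟶ space M y, ∀ (z : Q) (α : y ⟶ z), z ∈ V → g ≫ arrowMap M α = h z α

/-- A co-finite part `SI` of the support of `M` inside `V` which is closed under predecessors, and
on which `M` is cofree. -/
structure IsCofreePart (M : Repr k Q) (V SI : Set Q) : Prop where
  subset : SI ⊆ V
  subset_supp : SI ⊆ supp M
  closed : ∀ ⦃x y : Q⦄, (x ⟶ y) → y ∈ SI → x ∈ SI
  cofree : ∀ y ∈ SI, RelCofree M V y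
  rank : ∃ r : Q → ℕ, ∀ y ∈ V, ∀ z ∈ V, (y ⟶ z) → r z < r y
  finite : ((supp M ∩ V) \ SI).Finite

theorem Reach.mem_of_predClosed {S T : Set Q} (hT : ∀ ⦃x y : Q⦄, (x ⟶ y) → y ∈ T → x ∈ T)
    {x y : Q} (h : Reach S x y) (hy : y ∈ T) : x ∈ T := by
  obtain ⟨-, h⟩ := h
  induction h with
  | refl => exact hy
  | tail _ h ih => exact ih (hT h.2.some hy)

namespace IsCofreePart

variable {M : Repr k Q} {V SI : Set Q}

theorem mono (h : IsCofreePart M V SI) {SI' : Set Q} (hc : CofiniteIn SI' SI)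
    (hs : PredecessorClosedIn SI' SI) : IsCofreePart M V SI' where
  subset := hc.1.trans h.subset
  subset_supp := hc.1.trans h.subset_supp
  closed x y α hy := hs.2 x y ⟨h.closed α (hc.1 hy), .single ⟨hc.1 hy, ⟨α⟩⟩⟩ hy
  cofree y hy := h.cofree y (hc.1 hy)
  rank := h.rank
  finite := (h.finite.union hc.2).subset fun x hx => by
    by_cases hx' : x ∈ SI
    · exact Or.inr ⟨hx', hx.2⟩
    · exact Or.inl ⟨hx.1, hx'⟩

open Classical in
/-- A family of linear maps on `SI`, defined by recursion against the arrows. -/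
def coextend (h : IsCofreePart M V SI) (X : Repr k Q)
    (g : ∀ y z : Q, (y ⟶ z) → (space X y ⟶ space M z)) (y : Q) : space X y ⟶ space M y :=
  if hy : y ∈ SI then
    ((h.cofree y hy).2 (space X y) (fun z α =>
      if hz : z ∈ SI then
        have : h.rank.choose z < h.rank.choose y :=
          h.rank.choose_spec y (h.subset hy) z (h.subset hz) α
        arrowMap X α ≫ coextend h X g z
      else g y z α)).choose
  else 0
termination_by h.rank.choose y

open Classical in
theorem coextend_arrowMap (h : IsCofreePart M V SI) (X : Repr k Q)
    (g : ∀ y z : Q, (y ⟶ z) → (space X y ⟶ space M z)) {y z : Q} (α : y ⟶ z)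
    (hy : y ∈ SI) (hz : z ∈ V) :
    h.coextend X g y ≫ arrowMap M α =
      if z ∈ SI then arrowMap X α ≫ h.coextend X g z else g y z α := by
  have e : h.coextend X g y = ((h.cofree y hy).2 (space X y) (fun z α =>
      if z ∈ SI then arrowMap X α ≫ h.coextend X g z else g y z α)).choose := by
    rw [coextend]
    exact dif_pos hy
  rw [e]
  exact ((h.cofree y hy).2 (space X y) (fun z α =>
      if z ∈ SI then arrowMap X α ≫ h.coextend X g z else g y z α)).choose_spec.1 z α hz

theorem family_ext (h : IsCofreePart M V SI) {X : Repr k Q} {φ ψ : ∀ x : Q, space X x ⟶ space M x}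
    (hφ : ∀ ⦃x y : Q⦄ (α : x ⟶ y), y ∈ SI → arrowMap X α ≫ φ y = φ x ≫ arrowMap M α)
    (hψ : ∀ ⦃x y : Q⦄ (α : x ⟶ y), y ∈ SI → arrowMap X α ≫ ψ y = ψ x ≫ arrowMap M α)
    (he : ∀ ⦃x y : Q⦄ (α : x ⟶ y), y ∈ V → y ∉ SI → x ∈ SI →
      φ x ≫ arrowMap M α = ψ x ≫ arrowMap M α) {x : Q} (hx : x ∈ SI) : φ x = ψ x := by
  obtain ⟨r, hr⟩ := h.rank
  induction hn : r x using Nat.strong_induction_on generalizing x with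
  | _ n ih =>
    refine ((h.cofree x hx).2 (space X x) (fun z α => ψ x ≫ arrowMap M α)).unique
      (fun z α hz => ?_) (fun _ _ _ => rfl)
    by_cases hz' : z ∈ SI
    · rw [← hφ α hz', ← hψ α hz', ih (r z) (hn ▸ hr x (h.subset hx) z hz α) hz' rfl]
    · exact he α hz hz' hx

theorem exists_arrow (h : IsCofreePart M V SI) {y : Q} (hy : y ∈ SI) :
    ∃ z ∈ supp M ∩ V, Nonempty (y ⟶ z) := by
  by_contra! hc
  refine not_mem_supp_iff.2 ?_ (h.subset_supp hy)
  rw [IsZero.iff_id_eq_zero]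
  refine ((h.cofree y hy).2 (space M y) (fun z α => 0)).unique (fun z α hz => ?_)
    (fun _ _ _ => zero_comp)
  refine (not_mem_supp_iff.1 fun hz' => ?_).eq_of_tgt _ _
  exact (hc z ⟨hz', hz⟩).false α

theorem finite_leaving (hQ : StronglyLocallyFinite Q) (h : IsCofreePart M V SI) :
    {e : Σ (y : Q) (x : Q), (x ⟶ y) | e.1 ∈ (supp M ∩ V) \ SI ∧ e.2.1 ∈ SI}.Finite := by
  refine (h.finite.biUnion fun y _ =>
    @Set.finite_range _ _ (fun e : Σ x : Q, (x ⟶ y) => (⟨y, e⟩ : Σ (y : Q) (x : Q), (x ⟶ y)))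
      (hQ.finite_in y)).subset ?_
  rintro ⟨y, e⟩ hy
  exact Set.mem_biUnion hy.1 ⟨e, rfl⟩

theorem socleFinite (hQ : StronglyLocallyFinite Q) (h : IsCofreePart M V SI) : SocleFinite SI := by
  constructor
  · refine ((h.finite_leaving hQ).image (fun e => e.2.1)).subset ?_
    rintro y ⟨hy, hy'⟩
    obtain ⟨z, hz, ⟨α⟩⟩ := h.exists_arrow hy
    exact ⟨⟨z, y, α⟩, ⟨⟨hz, fun hz' => (hy' z hz').false α⟩, hy⟩, rfl⟩
  · obtain ⟨r, hr⟩ := h.rank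
    intro x hx
    induction hn : r x using Nat.strong_induction_on generalizing x with
    | _ n ih =>
      by_cases hs : IsSinkIn SI x
      · exact ⟨x, hs, hx, .refl⟩
      · obtain ⟨z, hz, ⟨α⟩⟩ : ∃ z ∈ SI, Nonempty (x ⟶ z) := by
          by_contra! hc
          exact hs ⟨hx, hc⟩
        obtain ⟨s, hs, hs'⟩ := ih (r z) (hn ▸ hr x (h.subset hx) z (h.subset hz) α) z hz rfl
        exact ⟨s, hs, hx, .head ⟨hz, ⟨α⟩⟩ hs'.2⟩

end IsCofreePart

/-! ## The representations `I_a` -/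

/-- The coordinate on `I_a(x)` given by a path `p` from `x` to `a`. -/
def pathCoord (k : Type u) [Field k] {a x : Q} (p : Quiver.Path x a) :
    space (injRep k Q a) x →ₗ[k] k :=
  LinearMap.proj (R := k) (φ := fun _ : Quiver.Path x a => k) p

theorem injRep_lhom_ext {a x : Q} {W : ModuleCat.{max u v w} k}
    {f g : W ⟶ space (injRep k Q a) x}
    (h : ∀ (p : Quiver.Path x a) (m : W), pathCoord k p (f.hom m) = pathCoord k p (g.hom m)) :
    f = g :=
  ModuleCat.hom_ext (LinearMap.ext fun m => funext fun p => h p m)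

/-- The linear map to `I_a(x)` with given coordinates. -/
def injLift {a x : Q} {W : ModuleCat.{max u v w} k} (m : Quiver.Path x a → (W →ₗ[k] k)) :
    W ⟶ space (injRep k Q a) x :=
  ModuleCat.ofHom (LinearMap.pi m)

theorem pathCoord_injLift {a x : Q} {W : ModuleCat.{max u v w} k}
    (m : Quiver.Path x a → (W →ₗ[k] k)) (p : Quiver.Path x a) (e : W) :
    pathCoord k p ((injLift m).hom e) = m p e := rfl

theorem pathCoord_arrowMap {a x y : Q} (p : Quiver.Path y a) (α : x ⟶ y)
    (m : space (injRep k Q a) x) :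
    pathCoord k p ((arrowMap (injRep k Q a) α).hom m) = pathCoord k (α.toPath.comp p) m := by
  have : arrowMap (injRep k Q a) α = ModuleCat.ofHom
      (LinearMap.funLeft k k (fun p : Quiver.Path y a => α.toPath.comp p)) :=
    Paths.lift_toPath _ α
  rw [this]
  rfl

theorem pathCoord_pathMap {a x y : Q} (p : Quiver.Path x y) (q : Quiver.Path y a)
    (m : space (injRep k Q a) x) :
    pathCoord k q ((pathMap (injRep k Q a) p).hom m) = pathCoord k (p.comp q) m := by
  induction p with
  | nil => rw [pathMap_nil, Quiver.Path.nil_comp]; rfl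
  | cons p α ih =>
    rw [pathMap_cons, hom_comp_apply, pathCoord_arrowMap, ih, ← Quiver.Path.comp_assoc]
    rfl

theorem injRep_hom_ext {a : Q} {X : Repr k Q} {f g : X ⟶ injRep k Q a}
    (h : ∀ m, pathCoord k .nil ((vmap f a).hom m) = pathCoord k .nil ((vmap g a).hom m)) :
    f = g := by
  refine hom_ext_vmap fun x => injRep_lhom_ext fun p m => ?_
  have := h ((pathMap X p).hom m)
  rwa [← hom_comp_apply, ← hom_comp_apply, vmap_pathMap, vmap_pathMap,
    hom_comp_apply, hom_comp_apply, pathCoord_pathMap, pathCoord_pathMap,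
    Quiver.Path.comp_nil] at this

/-- The morphism `X ⟶ I_a` given by a linear form on `X(a)`. -/
def injDesc {a : Q} (X : Repr k Q) (φ : space X a →ₗ[k] k) : X ⟶ injRep k Q a :=
  homMk (fun _ => injLift fun p => φ.comp (pathMap X p).hom) (fun x y α =>
    injRep_lhom_ext fun p m => by
      rw [hom_comp_apply, hom_comp_apply, pathCoord_injLift, pathCoord_arrowMap,
        pathCoord_injLift, pathMap_comp]
      rfl)

theorem injDesc_nil {a : Q} (X : Repr k Q) (φ : space X a →ₗ[k] k) (m : space X a) :
    pathCoord k .nil ((vmap (injDesc X φ) a).hom m) = φ m :=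
  congrArg (fun f => φ (f.hom m)) (pathMap_nil X a)

/-- Morphisms `X ⟶ I_a` are linear forms on `X(a)`, and these extend along injections because
subspaces have complements. -/
instance injective_injRep (a : Q) : Injective (injRep k Q a) where
  factors {X Y} g f _ := by
    obtain ⟨s, hs⟩ := LinearMap.exists_leftInverse_of_injective (vmap f a).hom
      (LinearMap.ker_eq_bot.2 ((ModuleCat.mono_iff_injective (vmap f a)).1 inferInstance))
    refine ⟨injDesc Y (((pathCoord k .nil).comp (vmap g a).hom).comp s), injRep_hom_ext fun m => ?_⟩
    rw [vmap_comp, hom_comp_apply, injDesc_nil]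
    exact congrArg (fun m => pathCoord k .nil ((vmap g a).hom m)) (LinearMap.congr_fun hs m)

/-! ## Injective objects of `rep⁻(Q)` -/

instance injective_biproduct_injRep {ι : Type*} [Finite ι] (x : ι → Q) :
    Injective (⨁ fun i => injRep k Q (x i)) where
  factors g f _ :=
    ⟨biproduct.lift fun i => Injective.factorThru (g ≫ biproduct.π (fun i => injRep k Q (x i)) i) f,
      biproduct.hom_ext _ _ fun i => by simp⟩

theorem repMinus_of_finite {ι κ : Type*} [Finite ι] [Finite κ] {x : ι → Q} {y : κ → Q}
    {M : Repr k Q} (f : M ⟶ ⨁ fun i => injRep k Q (x i))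
    (g : (⨁ fun i => injRep k Q (x i)) ⟶ ⨁ fun j => injRep k Q (y j)) (h : f ≫ g = 0)
    (hex : (ShortComplex.mk f g h).Exact) (hf : Mono f) : repMinus k Q M := by
  obtain ⟨m, ⟨e⟩⟩ := Finite.exists_equiv_fin ι
  obtain ⟨n, ⟨e'⟩⟩ := Finite.exists_equiv_fin κ
  let φ : (⨁ fun i => injRep k Q (x i)) ≅ ⨁ fun i => injRep k Q (x (e.symm i)) :=
    biproduct.whiskerEquiv e fun j => eqToIso (by simp)
  let ψ : (⨁ fun i => injRep k Q (y i)) ≅ ⨁ fun i => injRep k Q (y (e'.symm i)) :=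
    biproduct.whiskerEquiv e' fun j => eqToIso (by simp)
  refine ⟨m, n, _, _, f ≫ φ.hom, φ.inv ≫ g ≫ ψ.hom, by simp [reassoc_of% h], ?_, mono_comp _ _⟩
  let T := ShortComplex.mk (f ≫ φ.hom) (φ.inv ≫ g ≫ ψ.hom) (by simp [reassoc_of% h])
  let e : ShortComplex.mk f g h ≅ T :=
    ShortComplex.isoMk (Iso.refl _) φ ψ (by simp [T]) (by simp [T])
  exact ShortComplex.exact_of_iso e hex

/-- Dual of `repPlus_of_exact`: the kernel embeds into the injectives of `B`, cut out by the
equations of `B` together with extensions of the coordinates of `C`. -/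
theorem repMinus_of_exact {A B C : Repr k Q} (hB : repMinus k Q B) (hC : repMinus k Q C)
    (c : A ⟶ B) (f : B ⟶ C) (h : c ≫ f = 0) (hex : (ShortComplex.mk c f h).Exact) (hc : Mono c) :
    repMinus k Q A := by
  obtain ⟨n, -, y, -, gC, -, -, -, hgC⟩ := hC
  obtain ⟨n', m', y', x', gB, fB, hB, hBex, hgB⟩ := hB
  let l := Injective.factorThru (f ≫ gC) gB
  have hl : gB ≫ l = f ≫ gC := Injective.comp_factorThru _ _
  let d : (⨁ fun j => injRep k Q (y' j)) ⟶
      ⨁ fun s : Fin m' ⊕ Fin n => injRep k Q (Sum.elim x' y s) :=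
    biproduct.lift fun s => match s with
      | .inl i => fB ≫ biproduct.π (fun i => injRep k Q (x' i)) i
      | .inr j => l ≫ biproduct.π (fun j => injRep k Q (y j)) j
  have hd1 (i) {T : Repr k Q} (t : T ⟶ ⨁ fun j => injRep k Q (y' j)) :
      (t ≫ d) ≫ biproduct.π (fun s : Fin m' ⊕ Fin n => injRep k Q (Sum.elim x' y s)) (.inl i) =
        (t ≫ fB) ≫ biproduct.π (fun i => injRep k Q (x' i)) i :=
    (Category.assoc _ _ _).trans
      ((congrArg (t ≫ ·) (biproduct.lift_π _ _)).trans (Category.assoc _ _ _).symm)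
  have hd2 (i) {T : Repr k Q} (t : T ⟶ ⨁ fun j => injRep k Q (y' j)) :
      (t ≫ d) ≫ biproduct.π (fun s : Fin m' ⊕ Fin n => injRep k Q (Sum.elim x' y s)) (.inr i) =
        (t ≫ l) ≫ biproduct.π (fun i => injRep k Q (y i)) i :=
    (Category.assoc _ _ _).trans
      ((congrArg (t ≫ ·) (biproduct.lift_π _ _)).trans (Category.assoc _ _ _).symm)
  have hd : ∀ {T : Repr k Q} (t : T ⟶ ⨁ fun j => injRep k Q (y' j)),
      t ≫ d = 0 ↔ t ≫ fB = 0 ∧ t ≫ l = 0 := by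
    intro T t
    constructor
    · intro ht
      constructor
      · refine biproduct.hom_ext _ _ fun i => ?_
        rw [← hd1, ht, zero_comp, zero_comp]
        rfl
      · refine biproduct.hom_ext _ _ fun i => ?_
        rw [← hd2, ht, zero_comp, zero_comp]
        rfl
    · rintro ⟨h1, h2⟩
      refine biproduct.hom_ext _ _ fun i => ?_
      rcases i with i | i
      · rw [hd1, h1, zero_comp, zero_comp]
        rfl
      · rw [hd2, h2, zero_comp, zero_comp]
        rfl
  have w : (c ≫ gB) ≫ d = 0 := by
    rw [hd, Category.assoc, hB, comp_zero, Category.assoc, hl, ← Category.assoc, h, zero_comp]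
    exact ⟨rfl, rfl⟩
  have key : ∀ {T : Repr k Q} (t : T ⟶ ⨁ fun j => injRep k Q (y' j)), t ≫ d = 0 →
      ∃ s : T ⟶ A, s ≫ c ≫ gB = t := by
    intro T t ht
    rw [hd] at ht
    obtain ⟨s, hs⟩ : ∃ s : T ⟶ B, s ≫ gB = t := ⟨hBex.lift t ht.1, hBex.lift_f t ht.1⟩
    have hfs : s ≫ f = 0 := by
      rw [← cancel_mono gC, Category.assoc, ← hl, ← Category.assoc, hs, ht.2, zero_comp]
    refine ⟨hex.lift s hfs, ?_⟩
    rw [← Category.assoc]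
    exact (congrArg (· ≫ gB) (hex.lift_f s hfs)).trans hs
  refine repMinus_of_finite (c ≫ gB) d w ?_ (mono_comp _ _)
  refine ShortComplex.exact_of_f_is_kernel _ (KernelFork.IsLimit.ofι _ w
    (fun t ht => (key t ht).choose) (fun t ht => (key t ht).choose_spec) fun t ht s hs => ?_)
  rw [← cancel_mono (c ≫ gB), (key t ht).choose_spec, hs]

theorem mono_of_mono_repMinus {A B : (repMinus k Q).FullSubcategory} (f : A ⟶ B) [Mono f] :
    Mono f.hom := by
  have hC : repMinus k Q (kernel f.hom) :=
    repMinus_of_exact A.property B.property (kernel.ι f.hom) f.hom (kernel.condition _)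
      (ShortComplex.exact_kernel _) inferInstance
  refine Preadditive.mono_of_kernel_zero ?_
  let c : ⟨kernel f.hom, hC⟩ ⟶ A := ObjectProperty.homMk (kernel.ι f.hom)
  have : c = ObjectProperty.homMk 0 := by
    rw [← cancel_mono f]
    ext1
    simp [c]
  exact congrArg (fun φ => φ.hom) this

theorem isInjective_of_iso {ι : Type*} [Finite ι] {x : ι → Q} {M : Repr k Q}
    (e : M ≅ ⨁ fun i => injRep k Q (x i)) : IsInjective M := by
  have hM : repMinus k Q M := by
    refine repMinus_of_finite (κ := Fin 0) (y := Fin.elim0) e.hom 0 comp_zero ?_ inferInstance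
    exact (ShortComplex.exact_iff_epi _ rfl).2 inferInstance
  have : Injective M := Injective.of_iso e.symm inferInstance
  refine ⟨hM, ⟨fun {X Y} g f _ => ?_⟩⟩
  have := mono_of_mono_repMinus f
  exact ⟨ObjectProperty.homMk (Injective.factorThru g.hom f.hom), by ext1; simp⟩

namespace IsCofreePart

variable {M : Repr k Q} {V SI : Set Q}

/-- Each arrow `x ⟶ y` leaving `SI` contributes `dim M(y)` copies of `I_x`, one for each basis
coordinate of `M(y)` pulled back along the arrow. -/
theorem isInjective (hQ : StronglyLocallyFinite Q) (hM : LocallyFiniteDimensional M)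
    (h : IsCofreePart M V SI) : IsInjective (restrict M SI) := by
  classical
  let E := {e : Σ (y : Q) (x : Q), (x ⟶ y) // e.1 ∈ (supp M ∩ V) \ SI ∧ e.2.1 ∈ SI}
  have : Finite E := h.finite_leaving hQ
  have hfd : ∀ x, FiniteDimensional k (space M x) := hM
  let I := Σ e : E, Fin (Module.finrank k (space M e.1.1))
  let b (x : Q) := Module.finBasis k (space M x)
  let P : Repr k Q := ⨁ fun i : I => injRep k Q i.1.1.2.1
  let π (i : I) : P ⟶ injRep k Q i.1.1.2.1 := biproduct.π (fun i : I => injRep k Q i.1.1.2.1) i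
  let R := restrict M SI
  let Φ : R ⟶ P := biproduct.lift fun i : I =>
    injDesc R (((b i.1.1.1).coord i.2).comp (resIncl M SI i.1.1.2.1 ≫ arrowMap M i.1.1.2.2).hom)
  have hΦ (i : I) (m : space R i.1.1.2.1) :
      pathCoord k .nil ((vmap (π i) i.1.1.2.1).hom ((vmap Φ i.1.1.2.1).hom m)) =
        (b i.1.1.1).coord i.2 ((resIncl M SI i.1.1.2.1 ≫ arrowMap M i.1.1.2.2).hom m) := by
    rw [← hom_comp_apply, ← vmap_comp, biproduct.lift_π, injDesc_nil]
    rfl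
  let g (x y : Q) (α : x ⟶ y) : space P x ⟶ space M y :=
    if he : y ∈ (supp M ∩ V) \ SI ∧ x ∈ SI then
      ModuleCat.ofHom ((b y).equivFun.symm.toLinearMap.comp (LinearMap.pi fun j =>
        (pathCoord k .nil).comp (vmap (π ⟨⟨⟨y, x, α⟩, he⟩, j⟩) x).hom))
    else 0
  have hg (x y : Q) (α : x ⟶ y) (he : y ∈ (supp M ∩ V) \ SI ∧ x ∈ SI) j (m : space P x) :
      (b y).coord j ((g x y α).hom m) =
        pathCoord k .nil ((vmap (π ⟨⟨⟨y, x, α⟩, he⟩, j⟩) x).hom m) := by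
    have : g x y α = ModuleCat.ofHom ((b y).equivFun.symm.toLinearMap.comp (LinearMap.pi fun j =>
        (pathCoord k .nil).comp (vmap (π ⟨⟨⟨y, x, α⟩, he⟩, j⟩) x).hom)) := dif_pos he
    rw [this]
    exact congrFun ((b y).equivFun.apply_symm_apply _) j
  have hin {x y : Q} (α : x ⟶ y) (hy : y ∈ SI) :
      arrowMap P α ≫ h.coextend P g y = h.coextend P g x ≫ arrowMap M α := by
    rw [h.coextend_arrowMap P g α (h.closed α hy) (h.subset hy), if_pos hy]
  have hout {x y : Q} (α : x ⟶ y) (hyV : y ∈ V) (hy : y ∉ SI) (hx : x ∈ SI) :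
      h.coextend P g x ≫ arrowMap M α = g x y α := by
    rw [h.coextend_arrowMap P g α hx hyV, if_neg hy]
  let Ψ : P ⟶ R := homMk (fun x => h.coextend P g x ≫ resProj M SI x) fun x y α => by
    by_cases hy : y ∈ SI
    · rw [arrowMap_restrict, ← Category.assoc, hin α hy]
      simp only [Category.assoc]
      rw [← Category.assoc (resProj M SI x), resProj_resIncl M (h.closed α hy), Category.id_comp]
    · exact (isZero_restrict_space M hy).eq_of_tgt _ _
  have h1 {x : Q} (hx : x ∈ SI) : vmap Φ x ≫ h.coextend P g x = resIncl M SI x := by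
    refine h.family_ext (X := R) (φ := fun x => vmap Φ x ≫ h.coextend P g x) (ψ := resIncl M SI)
      (fun x y α hy => ?_) (fun x y α hy => ?_) (fun x y α hyV hy hx => ?_) hx
    · rw [Category.assoc, ← hin α hy, ← Category.assoc, ← Category.assoc, vmap_naturality]
    · rw [arrowMap_restrict, Category.assoc, Category.assoc, resProj_resIncl M hy,
        Category.comp_id]
    · rw [Category.assoc, hout α hyV hy hx]
      by_cases hys : y ∈ supp M
      · refine ModuleCat.hom_ext (LinearMap.ext fun m => (b y).ext_elem fun j => ?_)
        have he : y ∈ (supp M ∩ V) \ SI ∧ x ∈ SI := ⟨⟨⟨hys, hyV⟩, hy⟩, hx⟩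
        exact (hg x y α he j _).trans (hΦ ⟨⟨⟨y, x, α⟩, he⟩, j⟩ m)
      · exact (not_mem_supp_iff.1 hys).eq_of_tgt _ _
  refine isInjective_of_iso (ι := I) (x := fun i => i.1.1.2.1) (M := R) ⟨Φ, Ψ, ?_, ?_⟩
  · refine hom_ext_vmap fun x => ?_
    by_cases hx : x ∈ SI
    · rw [vmap_comp, vmap_homMk, ← Category.assoc, h1 hx, resIncl_resProj, vmap_id]
    · exact (isZero_restrict_space M hx).eq_of_src _ _
  · refine biproduct.hom_ext _ _ fun i => injRep_hom_ext fun m => ?_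
    rw [Category.id_comp, vmap_comp, vmap_comp, hom_comp_apply, hom_comp_apply]
    refine (hΦ i _).trans ?_
    rw [vmap_homMk, ← hom_comp_apply, Category.assoc, ← Category.assoc (resProj M SI _),
      resProj_resIncl M i.1.2.2, Category.id_comp,
      hout i.1.1.2.2 i.1.2.1.1.2 i.1.2.1.2 i.1.2.2]
    exact hg _ _ _ i.1.2 i.2 m

end IsCofreePart

/-! ## Endomorphisms of `M` and of its restrictions -/

theorem restrict_hom_ext {M N : Repr k Q} {S : Set Q} {f g : restrict M S ⟶ N}
    (h : ∀ x ∈ S, vmap f x = vmap g x) : f = g := by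
  refine hom_ext_vmap fun x => ?_
  by_cases hx : x ∈ S
  · exact h x hx
  · exact (isZero_restrict_space M hx).eq_of_src _ _

/-- The restriction of a morphism to a full subquiver. -/
def restrictHom {M N : Repr k Q} (e : M ⟶ N) (S : Set Q) : restrict M S ⟶ restrict N S :=
  homMk (fun x => resIncl M S x ≫ vmap e x ≫ resProj N S x) fun x y α => by
    by_cases hx : x ∈ S
    · by_cases hy : y ∈ S
      · simp only [arrowMap_restrict, Category.assoc]
        rw [← Category.assoc (resProj M S y), resProj_resIncl M hy, Category.id_comp,
          ← Category.assoc (resProj N S x), resProj_resIncl N hx, Category.id_comp,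
          ← Category.assoc (arrowMap M α), vmap_naturality, Category.assoc]
      · exact (isZero_restrict_space N hy).eq_of_tgt _ _
    · exact (isZero_restrict_space M hx).eq_of_src _ _

theorem vmap_restrictHom {M N : Repr k Q} (e : M ⟶ N) (S : Set Q) (x : Q) :
    vmap (restrictHom e S) x = resIncl M S x ≫ vmap e x ≫ resProj N S x := rfl

theorem restrictHom_comp {M N K : Repr k Q} (e : M ⟶ N) (f : N ⟶ K) (S : Set Q) :
    restrictHom (e ≫ f) S = restrictHom e S ≫ restrictHom f S := by
  refine restrict_hom_ext fun x hx => ?_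
  simp only [vmap_restrictHom, vmap_comp, Category.assoc]
  rw [← Category.assoc (resProj N S x), resProj_resIncl N hx, Category.id_comp]

theorem restrictHom_id (M : Repr k Q) (S : Set Q) : restrictHom (𝟙 M) S = 𝟙 _ := by
  refine hom_ext_vmap fun x => ?_
  rw [vmap_restrictHom, vmap_id, Category.id_comp, resIncl_resProj, vmap_id]

theorem restrictHom_zero (M N : Repr k Q) (S : Set Q) :
    restrictHom (0 : M ⟶ N) S = 0 := by
  refine hom_ext_vmap fun x => ?_
  rw [vmap_restrictHom, vmap_zero, zero_comp, comp_zero, vmap_zero]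

theorem vmap_eq_of_restrictHom_eq {M N : Repr k Q} {e f : M ⟶ N} {S : Set Q}
    (h : restrictHom e S = restrictHom f S) {x : Q} (hx : x ∈ S) : vmap e x = vmap f x := by
  have key (e : M ⟶ N) : resProj M S x ≫ vmap (restrictHom e S) x ≫ resIncl N S x = vmap e x := by
    rw [vmap_restrictHom, Category.assoc, Category.assoc, resProj_resIncl N hx, Category.comp_id,
      ← Category.assoc, resProj_resIncl M hx, Category.id_comp]
  rw [← key e, h, key f]

/-- A free part and a cofree part of `M` that together cover all but finitely many vertices of the
support of `M` and do not interact with each other. -/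
structure IsFreeCofreePair (M : Repr k Q) (U V SP SI : Set Q) : Prop where
  free : IsFreePart M U SP
  cofree : IsCofreePart M V SI
  cover : supp M ⊆ U ∪ V
  free_disjoint : ∀ x ∈ SP, x ∉ V
  cofree_disjoint : ∀ x ∈ SI, x ∉ U

namespace IsFreeCofreePair

variable {M : Repr k Q} {U V SP SI : Set Q}

/-- An arrow entering `SP` from `U` cannot start in `SI`, since `SI` misses `U`. It starts in `Ω` or
off the support, so the values on `Ω` determine those on `SP`; dually for `SI`. -/
theorem hom_ext (h : IsFreeCofreePair M U V SP SI) {e f : M ⟶ M}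
    (hef : ∀ x ∈ supp M \ (SP ∪ SI), vmap e x = vmap f x) : e = f := by
  refine hom_ext_vmap fun x => ?_
  by_cases hx : x ∈ supp M
  swap
  · exact (not_mem_supp_iff.1 hx).eq_of_src _ _
  by_cases hP : x ∈ SP
  · refine h.free.family_ext (φ := vmap e) (ψ := vmap f) (fun x y α _ => vmap_naturality e α)
      (fun x y α _ => vmap_naturality f α) (fun x y α hxU hx _ => ?_) hP
    by_cases hxs : x ∈ supp M
    · rw [vmap_naturality, vmap_naturality,
        hef x ⟨hxs, not_or.2 ⟨hx, fun hI => h.cofree_disjoint x hI hxU⟩⟩]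
    · exact (not_mem_supp_iff.1 hxs).eq_of_src _ _
  by_cases hI : x ∈ SI
  · refine h.cofree.family_ext (φ := vmap e) (ψ := vmap f) (fun x y α _ => vmap_naturality e α)
      (fun x y α _ => vmap_naturality f α) (fun x y α hyV hy _ => ?_) hI
    by_cases hys : y ∈ supp M
    · rw [← vmap_naturality, ← vmap_naturality,
        hef y ⟨hys, not_or.2 ⟨fun hP => h.free_disjoint y hP hyV, hy⟩⟩]
    · exact (not_mem_supp_iff.1 hys).eq_of_tgt _ _
  exact hef x ⟨hx, not_or.2 ⟨hP, hI⟩⟩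

theorem restrictHom_injective (h : IsFreeCofreePair M U V SP SI) {e f : M ⟶ M}
    (hef : restrictHom e (supp M \ (SP ∪ SI)) = restrictHom f (supp M \ (SP ∪ SI))) : e = f :=
  h.hom_ext fun _ hx => vmap_eq_of_restrictHom_eq hef hx

theorem restrictHom_surjective (h : IsFreeCofreePair M U V SP SI)
    (f : restrict M (supp M \ (SP ∪ SI)) ⟶ restrict M (supp M \ (SP ∪ SI))) :
    ∃ e : M ⟶ M, restrictHom e (supp M \ (SP ∪ SI)) = f := by
  classical
  let Ω := supp M \ (SP ∪ SI)
  let φ (x : Q) : space M x ⟶ space M x := resProj M Ω x ≫ vmap f x ≫ resIncl M Ω x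
  -- On arrows between `Ω` and `SP` or `SI`, naturality dictates the data to extend.
  let φP := h.free.extend M fun x y α => φ x ≫ arrowMap M α
  let φI := h.cofree.coextend M fun x y α => arrowMap M α ≫ φ y
  let ψ (x : Q) : space M x ⟶ space M x := if x ∈ SP then φP x else if x ∈ SI then φI x else φ x
  have hψP {x : Q} (hx : x ∈ SP) : ψ x = φP x := if_pos hx
  have hψI {x : Q} (hP : x ∉ SP) (hx : x ∈ SI) : ψ x = φI x := (if_neg hP).trans (if_pos hx)
  have hψ {x : Q} (hP : x ∉ SP) (hI : x ∉ SI) : ψ x = φ x := (if_neg hP).trans (if_neg hI)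
  have hPI {x : Q} (hP : x ∈ SP) : x ∉ SI := fun hI =>
    h.cofree_disjoint x hI (h.free.subset hP)
  have hcomm (x y : Q) (α : x ⟶ y) : arrowMap M α ≫ ψ y = ψ x ≫ arrowMap M α := by
    by_cases hy : y ∈ SP
    · by_cases hxU : x ∈ U
      · rw [hψP hy, h.free.arrowMap_extend _ _ α hy hxU]
        by_cases hx : x ∈ SP
        · rw [if_pos hx, hψP hx]
        · rw [if_neg hx, hψ hx fun hI => h.cofree_disjoint x hI hxU]
      -- Arrows into `SP` from outside `U`, in particular from `SI`, act by zero.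
      · rw [(h.free.free y hy).1 x α hxU, zero_comp, comp_zero]
    by_cases hx : x ∈ SI
    · have hxP : x ∉ SP := fun hP => hPI hP hx
      by_cases hyV : y ∈ V
      · rw [hψI hxP hx, h.cofree.coextend_arrowMap _ _ α hx hyV]
        by_cases hyI : y ∈ SI
        · rw [if_pos hyI, hψI hy hyI]
        · rw [if_neg hyI, hψ hy hyI]
      · rw [(h.cofree.cofree x hx).1 y α hyV, zero_comp, comp_zero]
    -- Closedness of both parts leaves only arrows within `Ω` or with an end off the support.
    have hxP : x ∉ SP := fun hP => hy (h.free.closed α hP)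
    have hyI : y ∉ SI := fun hI => hx (h.cofree.closed α hI)
    rw [hψ hy hyI, hψ hxP hx]
    by_cases hxs : x ∈ supp M
    swap
    · exact (not_mem_supp_iff.1 hxs).eq_of_src _ _
    by_cases hys : y ∈ supp M
    swap
    · exact (not_mem_supp_iff.1 hys).eq_of_tgt _ _
    have hxΩ : x ∈ Ω := ⟨hxs, not_or.2 ⟨hxP, hx⟩⟩
    have hyΩ : y ∈ Ω := ⟨hys, not_or.2 ⟨hy, hyI⟩⟩
    have hn := congrArg (fun a => resProj M Ω x ≫ a ≫ resIncl M Ω y) (vmap_naturality f α)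
    simp only [arrowMap_restrict, Category.assoc] at hn
    rw [← Category.assoc (resProj M Ω x), resProj_resIncl M hxΩ, Category.id_comp,
      resProj_resIncl M hyΩ, Category.comp_id] at hn
    simpa only [φ, Category.assoc] using hn
  refine ⟨homMk ψ hcomm, restrict_hom_ext fun x hx => ?_⟩
  rw [vmap_restrictHom, vmap_homMk, hψ (fun hP => hx.2 (.inl hP)) (fun hI => hx.2 (.inr hI))]
  simp only [φ, Category.assoc]
  rw [resIncl_resProj, Category.comp_id, ← Category.assoc, resIncl_resProj, Category.id_comp]

theorem nonempty (h : IsFreeCofreePair M U V SP SI) (hM : ¬ IsZero M) :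
    (supp M \ (SP ∪ SI)).Nonempty := by
  by_contra hc
  rw [Set.not_nonempty_iff_eq_empty] at hc
  refine hM ((IsZero.iff_id_eq_zero _).2 (h.hom_ext fun x hx => ?_))
  rw [hc] at hx
  exact hx.elim

theorem indecomposable_iff (h : IsFreeCofreePair M U V SP SI) :
    Indecomposable M ↔ Indecomposable (restrict M (supp M \ (SP ∪ SI))) := by
  simp only [indecomposable_iff_idempotent]
  have hinj {e f : M ⟶ M} := h.restrictHom_injective (e := e) (f := f)
  constructor
  · rintro ⟨hM, he⟩
    refine ⟨fun hz => ?_, fun f hf => ?_⟩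
    · have := supp_eq_empty_of_isZero hz
      rw [supp_restrict, Set.inter_eq_right.2 Set.sdiff_subset] at this
      exact (h.nonempty hM).ne_empty this
    · obtain ⟨e, rfl⟩ := h.restrictHom_surjective f
      rcases he e (hinj (by rw [restrictHom_comp, hf])) with rfl | rfl
      · exact .inl (restrictHom_zero _ _ _)
      · exact .inr (restrictHom_id _ _)
  · rintro ⟨hM, hf⟩
    refine ⟨fun hz => hM (isZero_of_supp_eq_empty ?_), fun e he => ?_⟩
    · rw [supp_restrict, supp_eq_empty_of_isZero hz, Set.empty_inter]
    · rcases hf (restrictHom e _) (by rw [← restrictHom_comp, he]) with h0 | h1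
      · exact .inl (hinj (h0.trans (restrictHom_zero _ _ _).symm))
      · exact .inr (hinj (h1.trans (restrictHom_id _ _).symm))

theorem mono (h : IsFreeCofreePair M U V SP SI) {SP' SI' : Set Q}
    (hP : CofiniteIn SP' SP) (hP' : SuccessorClosedIn SP' SP)
    (hI : CofiniteIn SI' SI) (hI' : PredecessorClosedIn SI' SI) :
    IsFreeCofreePair M U V SP' SI' where
  free := h.free.mono hP hP'
  cofree := h.cofree.mono hI hI'
  cover := h.cover
  free_disjoint x hx := h.free_disjoint x (hP.1 hx)
  cofree_disjoint x hx := h.cofree_disjoint x (hI.1 hx)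

theorem isSplitting (hQ : StronglyLocallyFinite Q) (hM : LocallyFiniteDimensional M)
    (hM0 : ¬ IsZero M) (h : IsFreeCofreePair M U V SP SI) : IsSplitting M SP SI where
  topFinite := h.free.topFinite hQ
  successorClosed := h.free.successorClosedIn
  projective := h.free.isProjective hQ hM
  socleFinite := h.cofree.socleFinite hQ
  predecessorClosed :=
    ⟨fun x hx => ⟨h.cofree.subset_supp hx, fun hP =>
      h.cofree_disjoint x hx (h.free.subset hP)⟩,
    fun _ _ hxy hy => hxy.mem_of_predClosed h.cofree.closed hy⟩
  injective := h.cofree.isInjective hQ hM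
  finite := (h.free.finite.union h.cofree.finite).subset fun _ hx =>
    (h.cover hx.1).imp (fun hU => ⟨⟨hx.1, hU⟩, fun hP => hx.2 (.inl hP)⟩)
      (fun hV => ⟨⟨hx.1, hV⟩, fun hI => hx.2 (.inr hI)⟩)
  nonempty := h.nonempty hM0
  indecomposable := h.indecomposable_iff.1
  -- One summand is even zero, and zero is the empty sum of `P_a`'s.
  indecomposableUpTo hΩ M₁ M₂ e :=
    ((h.indecomposable_iff.2 hΩ).2 M₁ M₂ e.some).imp
      (fun hz => .inl (isProjective_of_isZero hz)) (fun hz => .inl (isProjective_of_isZero hz))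

end IsFreeCofreePair

/-! ## Successors and predecessors of finite sets of vertices -/

/-- The successors of the vertices in `F`. -/
def succSet (F : Set Q) : Set Q := {x | ∃ a ∈ F, Nonempty (Quiver.Path a x)}

/-- The predecessors of the vertices in `G`. -/
def predSet (G : Set Q) : Set Q := {x | ∃ b ∈ G, Nonempty (Quiver.Path x b)}

theorem subset_succSet (F : Set Q) : F ⊆ succSet F := fun x hx => ⟨x, hx, ⟨.nil⟩⟩

theorem subset_predSet (G : Set Q) : G ⊆ predSet G := fun x hx => ⟨x, hx, ⟨.nil⟩⟩

theorem mem_succSet_of_arrow {F : Set Q} {x y : Q} (α : x ⟶ y) (hx : x ∈ succSet F) :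
    y ∈ succSet F := by
  obtain ⟨a, ha, ⟨p⟩⟩ := hx
  exact ⟨a, ha, ⟨p.cons α⟩⟩

theorem mem_predSet_of_arrow {G : Set Q} {x y : Q} (α : x ⟶ y) (hy : y ∈ predSet G) :
    x ∈ predSet G := by
  obtain ⟨b, hb, ⟨p⟩⟩ := hy
  exact ⟨b, hb, ⟨α.toPath.comp p⟩⟩

/-- Every such vertex lies on one of the finitely many paths from `F` to `G`. -/
theorem StronglyLocallyFinite.finite_succSet_inter_predSet (hQ : StronglyLocallyFinite Q)
    {F G : Set Q} (hF : F.Finite) (hG : G.Finite) : (succSet F ∩ predSet G).Finite := by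
  have hpath (a b : Q) : (⋃ p : Quiver.Path a b, {x | x ∈ p.vertices}).Finite := by
    have := hQ.finite_paths a b
    exact Set.finite_iUnion fun p => p.vertices.finite_toSet
  refine (hF.biUnion fun a _ => hG.biUnion fun b _ => hpath a b).subset ?_
  rintro x ⟨⟨a, ha, ⟨p⟩⟩, b, hb, ⟨q⟩⟩
  refine Set.mem_biUnion ha (Set.mem_biUnion hb (Set.mem_iUnion.2 ⟨p.comp q, ?_⟩))
  change x ∈ (p.comp q).vertices
  rw [Quiver.Path.vertices_comp]
  exact List.mem_append_right _ (Quiver.Path.start_mem_vertices q)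

/-- Take the length of a longest path from `F`; appending an arrow makes it longer. -/
theorem StronglyLocallyFinite.exists_rank_succSet (hQ : StronglyLocallyFinite Q)
    {F : Set Q} (hF : F.Finite) :
    ∃ r : Q → ℕ, ∀ z ∈ succSet F, ∀ y ∈ succSet F, (z ⟶ y) → r z < r y := by
  let S (y : Q) : Set ℕ := ⋃ a ∈ F, Set.range (fun p : Quiver.Path a y => p.length)
  have hS (y : Q) : (S y).Finite := hF.biUnion fun a _ => by
    have := hQ.finite_paths a y
    exact Set.finite_range _
  refine ⟨fun y => sSup (S y), fun z hz y _ α => ?_⟩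
  have hne : (S z).Nonempty := by
    obtain ⟨a, ha, ⟨p⟩⟩ := hz
    exact ⟨_, Set.mem_biUnion ha ⟨p, rfl⟩⟩
  have hm := Nat.sSup_mem hne (hS z).bddAbove
  simp only [S, Set.mem_iUnion, Set.mem_range] at hm
  obtain ⟨a, ha, p, hp⟩ := hm
  refine Nat.lt_of_succ_le (le_csSup (hS y).bddAbove (Set.mem_biUnion ha ⟨p.cons α, ?_⟩))
  exact (Quiver.Path.length_cons _ _ _ p α).trans (congrArg Nat.succ hp)

theorem StronglyLocallyFinite.exists_rank_predSet (hQ : StronglyLocallyFinite Q)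
    {G : Set Q} (hG : G.Finite) :
    ∃ r : Q → ℕ, ∀ y ∈ predSet G, ∀ z ∈ predSet G, (y ⟶ z) → r z < r y := by
  let S (y : Q) : Set ℕ := ⋃ b ∈ G, Set.range (fun p : Quiver.Path y b => p.length)
  have hS (y : Q) : (S y).Finite := hG.biUnion fun b _ => by
    have := hQ.finite_paths y b
    exact Set.finite_range _
  refine ⟨fun y => sSup (S y), fun y _ z hz α => ?_⟩
  have hne : (S z).Nonempty := by
    obtain ⟨b, hb, ⟨p⟩⟩ := hz
    exact ⟨_, Set.mem_biUnion hb ⟨p, rfl⟩⟩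
  have hm := Nat.sSup_mem hne (hS z).bddAbove
  simp only [S, Set.mem_iUnion, Set.mem_range] at hm
  obtain ⟨b, hb, p, hp⟩ := hm
  refine Nat.lt_of_succ_le (le_csSup (hS y).bddAbove (Set.mem_biUnion hb ⟨α.toPath.comp p, ?_⟩))
  exact (Quiver.Path.length_comp _ _).trans ((add_comm _ _).trans (congrArg Nat.succ hp))

/-! ## Finitely presented representations are free at almost all vertices -/

/-- `M(y)` is, via the maps `M(α)`, the direct sum of the `M(z)` over all arrows `α : z ⟶ y`. -/
def FreeAt (M : Repr k Q) (y : Q) : Prop :=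
  ∀ (W : ModuleCat.{max u v w} k) (h : ∀ z : Q, (z ⟶ y) → (space M z ⟶ W)),
    ∃! g : space M y ⟶ W, ∀ (z : Q) (α : z ⟶ y), arrowMap M α ≫ g = h z α

/-- `M(y)` is, via the maps `M(α)`, the product of the `M(z)` over all arrows `α : y ⟶ z`. -/
def CofreeAt (M : Repr k Q) (y : Q) : Prop :=
  ∀ (W : ModuleCat.{max u v w} k) (h : ∀ z : Q, (y ⟶ z) → (W ⟶ space M z)),
    ∃! g : W ⟶ space M y, ∀ (z : Q) (α : y ⟶ z), g ≫ arrowMap M α = h z α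

theorem freeAt_projRep {a y : Q} (hy : y ≠ a) : FreeAt (projRep k Q a) y := by
  intro W h
  let m (p : Quiver.Path a y) : W := match y, p, h with
    -- A dummy value: the trivial path occurs only when `y = a`.
    | _, .nil, _ => 0
    | _, .cons q α, h => (h _ α).hom (pathElt k q)
  refine ⟨projLift m, fun z α => projRep_lhom_ext fun p => ?_, fun g hg =>
    projRep_lhom_ext fun p => ?_⟩
  · rw [hom_comp_apply, arrowMap_pathElt, projLift_pathElt]
  · rw [projLift_pathElt]
    cases p with
    | nil => exact absurd rfl hy
    | cons q α =>
      rw [← arrowMap_pathElt, ← hom_comp_apply, hg]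

/-- Paths grow at their end, so unique factorization by the first arrow, unlike the last, needs an
induction. -/
theorem sigma_eq_of_toPath_comp_eq {a x y z : Q} {α : x ⟶ y} {β : x ⟶ z} {p : Quiver.Path y a}
    {q : Quiver.Path z a} (h : α.toPath.comp p = β.toPath.comp q) :
    (⟨y, α, p⟩ : Σ y : Q, (x ⟶ y) × Quiver.Path y a) = ⟨z, β, q⟩ := by
  induction p with
  | nil =>
    cases q with
    | nil =>
      obtain rfl : α = β := eq_of_heq (Quiver.Path.hom_heq_of_cons_eq_cons h)
      rfl
    | cons q e =>
      have := congrArg Quiver.Path.length h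
      simp at this
  | cons p e ih =>
    cases q with
    | nil =>
      have := congrArg Quiver.Path.length h
      simp at this
    | cons q e' =>
      rw [Quiver.Path.comp_cons, Quiver.Path.comp_cons] at h
      obtain rfl := Quiver.Path.obj_eq_of_cons_eq_cons h
      obtain rfl := eq_of_heq (Quiver.Path.hom_heq_of_cons_eq_cons h)
      have := ih (eq_of_heq (Quiver.Path.heq_of_cons_eq_cons h))
      exact congrArg (fun s : Σ y : Q, (x ⟶ y) × Quiver.Path y _ =>
        (⟨s.1, s.2.1, s.2.2.cons e⟩ : Σ y : Q, (x ⟶ y) × Quiver.Path y _)) this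

theorem cofreeAt_injRep {a y : Q} (hy : y ≠ a) : CofreeAt (injRep k Q a) y := by
  intro W h
  have hcons (p : Quiver.Path y a) : ∃ (z : Q) (α : y ⟶ z) (q : Quiver.Path z a),
      p = α.toPath.comp q := by
    obtain ⟨n, hn⟩ : ∃ n, p.length = n + 1 := Nat.exists_eq_succ_of_ne_zero fun h0 =>
      hy (Quiver.Path.eq_of_length_zero p h0)
    obtain ⟨z, α, q, -, rfl⟩ := p.eq_toPath_comp_of_length_eq_succ hn
    exact ⟨z, α, q, rfl⟩
  choose z α q hq using hcons
  have hval (x : Q) (β : y ⟶ x) (r : Quiver.Path x a) (e : W) :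
      pathCoord k (q (β.toPath.comp r)) ((h _ (α (β.toPath.comp r))).hom e) =
        pathCoord k r ((h x β).hom e) := by
    have := sigma_eq_of_toPath_comp_eq (hq (β.toPath.comp r))
    exact (congrArg (fun s : Σ x : Q, (y ⟶ x) × Quiver.Path x a =>
      pathCoord k s.2.2 ((h s.1 s.2.1).hom e)) this).symm
  refine ⟨injLift fun p => (pathCoord k (q p)).comp (h _ (α p)).hom, fun x β =>
    injRep_lhom_ext fun p e => ?_, fun g hg => injRep_lhom_ext fun p e => ?_⟩
  · rw [hom_comp_apply, pathCoord_arrowMap, pathCoord_injLift]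
    exact hval x β p e
  · rw [pathCoord_injLift, LinearMap.comp_apply, ← hg, hom_comp_apply, pathCoord_arrowMap, ← hq]

/-! ### Freeness and cofreeness under finite sums, cokernels and kernels. -/

theorem biproduct_vmap_total {ι : Type} [Fintype ι] (X : ι → Repr k Q) (x : Q) :
    ∑ i, vmap (biproduct.π X i) x ≫ vmap (biproduct.ι X i) x = 𝟙 (space (⨁ X) x) := by
  have h := congrArg (fun f => vmap f x) (biproduct.total (C := Repr k Q) (f := X))
  simpa only [vmap, NatTrans.app_sum, NatTrans.comp_app, NatTrans.id_app] using h

theorem freeAt_biproduct {ι : Type} [Fintype ι] {X : ι → Repr k Q} {y : Q}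
    (hX : ∀ i, FreeAt (X i) y) : FreeAt (⨁ X) y := by
  intro W h
  choose g hg hg' using fun i => hX i W fun z α => vmap (biproduct.ι X i) z ≫ h z α
  refine ⟨∑ i, vmap (biproduct.π X i) y ≫ g i, fun z α => ?_, fun f hf => ?_⟩
  · rw [Preadditive.comp_sum, ← Category.id_comp (h z α), ← biproduct_vmap_total,
      Preadditive.sum_comp]
    refine Finset.sum_congr rfl fun i _ => ?_
    rw [← Category.assoc, vmap_naturality, Category.assoc, hg, Category.assoc]
  · rw [← Category.id_comp f, ← biproduct_vmap_total, Preadditive.sum_comp]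
    refine Finset.sum_congr rfl fun i _ => ?_
    rw [Category.assoc, ← hg' i (vmap (biproduct.ι X i) y ≫ f) fun z α => by
      rw [← Category.assoc, vmap_naturality, Category.assoc, hf]]

theorem cofreeAt_biproduct {ι : Type} [Fintype ι] {X : ι → Repr k Q} {y : Q}
    (hX : ∀ i, CofreeAt (X i) y) : CofreeAt (⨁ X) y := by
  intro W h
  choose g hg hg' using fun i => hX i W fun z α => h z α ≫ vmap (biproduct.π X i) z
  refine ⟨∑ i, g i ≫ vmap (biproduct.ι X i) y, fun z α => ?_, fun f hf => ?_⟩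
  · rw [Preadditive.sum_comp, ← Category.comp_id (h z α), ← biproduct_vmap_total,
      Preadditive.comp_sum]
    refine Finset.sum_congr rfl fun i _ => ?_
    rw [Category.assoc, ← vmap_naturality, ← Category.assoc, hg, Category.assoc]
  · rw [← Category.comp_id f, ← biproduct_vmap_total, Preadditive.comp_sum]
    refine Finset.sum_congr rfl fun i _ => ?_
    rw [← Category.assoc, ← hg' i (f ≫ vmap (biproduct.π X i) y) fun z α => by
      rw [Category.assoc, ← vmap_naturality, ← Category.assoc, hf]]

theorem exists_mem_supp_of_biproduct {ι : Type} [Fintype ι] {X : ι → Repr k Q} {x : Q}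
    (hx : x ∈ supp (⨁ X)) : ∃ i, x ∈ supp (X i) := by
  by_contra! hc
  refine not_mem_supp_iff.2 ?_ hx
  rw [IsZero.iff_id_eq_zero, ← biproduct_vmap_total]
  exact Finset.sum_eq_zero fun i _ => by
    rw [(not_mem_supp_iff.1 (hc i)).eq_of_tgt (vmap (biproduct.π X i) x) 0, zero_comp]

theorem nonempty_path_of_mem_supp_projRep {a x : Q} (hx : x ∈ supp (projRep k Q a)) :
    Nonempty (Quiver.Path a x) := by
  by_contra hc
  rw [not_nonempty_iff] at hc
  refine not_mem_supp_iff.2 ?_ hx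
  rw [IsZero.iff_id_eq_zero]
  exact projRep_lhom_ext fun p => hc.elim p

theorem nonempty_path_of_mem_supp_injRep {a x : Q} (hx : x ∈ supp (injRep k Q a)) :
    Nonempty (Quiver.Path x a) := by
  by_contra hc
  rw [not_nonempty_iff] at hc
  refine not_mem_supp_iff.2 ?_ hx
  rw [IsZero.iff_id_eq_zero]
  exact injRep_lhom_ext fun p => hc.elim p

theorem exact_vmap {A B C : Repr k Q} {f : A ⟶ B} {g : B ⟶ C} {h : f ≫ g = 0}
    (hex : (ShortComplex.mk f g h).Exact) (x : Q) :
    (ShortComplex.mk (vmap f x) (vmap g x) (congrArg (fun f => vmap f x) h)).Exact :=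
  hex.map ((evaluation _ _).obj ((Paths.of Q).obj x))

/-- The solution `b` of the problem pulled back to `B` vanishes on `A` by uniqueness there, so it
descends to `C`. -/
theorem freeAt_of_exact {A B C : Repr k Q} {f : A ⟶ B} {g : B ⟶ C} {h : f ≫ g = 0}
    (hex : (ShortComplex.mk f g h).Exact) (hg : Epi g) {y : Q} (hA : FreeAt A y)
    (hB : FreeAt B y) : FreeAt C y := by
  intro W m
  have hepi (x : Q) : Epi (vmap g x) := inferInstance
  obtain ⟨b, hb, hb'⟩ := hB W fun z α => vmap g z ≫ m z α
  have hfb : vmap f y ≫ b = 0 := by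
    refine (hA W fun z α => 0).unique (fun z α => ?_) fun z α => comp_zero
    rw [← Category.assoc, vmap_naturality, Category.assoc, hb, ← Category.assoc, ← vmap_comp, h,
      vmap_zero, zero_comp]
  have hey := exact_vmap hex y
  have hc : vmap g y ≫ hey.desc b hfb = b := hey.g_desc b hfb
  refine ⟨hey.desc b hfb, fun z α => ?_, fun c' hc' => ?_⟩
  · rw [← cancel_epi (vmap g z), ← Category.assoc, ← vmap_naturality, Category.assoc]
    exact (congrArg _ hc).trans (hb z α)
  · rw [← cancel_epi (vmap g y), hc]
    refine hb' _ fun z α => ?_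
    rw [← Category.assoc, vmap_naturality, Category.assoc, hc']

theorem cofreeAt_of_exact {A B C : Repr k Q} {f : A ⟶ B} {g : B ⟶ C} {h : f ≫ g = 0}
    (hex : (ShortComplex.mk f g h).Exact) (hf : Mono f) {y : Q} (hB : CofreeAt B y)
    (hC : CofreeAt C y) : CofreeAt A y := by
  intro W m
  have hmono (x : Q) : Mono (vmap f x) := inferInstance
  obtain ⟨b, hb, hb'⟩ := hB W fun z α => m z α ≫ vmap f z
  have hbg : b ≫ vmap g y = 0 := by
    refine (hC W fun z α => 0).unique (fun z α => ?_) fun z α => zero_comp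
    rw [Category.assoc, ← vmap_naturality, ← Category.assoc, hb, Category.assoc, ← vmap_comp, h,
      vmap_zero, comp_zero]
  have hey := exact_vmap hex y
  have hc : hey.lift b hbg ≫ vmap f y = b := hey.lift_f b hbg
  refine ⟨hey.lift b hbg, fun z α => ?_, fun c' hc' => ?_⟩
  · rw [← cancel_mono (vmap f z), Category.assoc, vmap_naturality, ← Category.assoc]
    exact (congrArg (· ≫ arrowMap B α) hc).trans (hb z α)
  · rw [← cancel_mono (vmap f y), hc]
    refine hb' _ fun z α => ?_
    rw [Category.assoc, ← vmap_naturality, ← Category.assoc, hc']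

theorem repPlus.exists_finite {L : Repr k Q} (hL : repPlus k Q L) :
    ∃ F : Set Q, F.Finite ∧ (∀ y ∉ F, FreeAt L y) ∧ supp L ⊆ succSet F := by
  obtain ⟨m, n, x, y, f, g, h, hex, hg⟩ := hL
  refine ⟨Set.range x ∪ Set.range y, (Set.finite_range x).union (Set.finite_range y),
    fun z hz => ?_, fun z hz => ?_⟩
  · rw [Set.mem_union, not_or] at hz
    exact freeAt_of_exact hex hg
      (freeAt_biproduct fun i => freeAt_projRep fun e => hz.1 ⟨i, e.symm⟩)
      (freeAt_biproduct fun i => freeAt_projRep fun e => hz.2 ⟨i, e.symm⟩)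
  · have hz' : z ∈ supp (⨁ fun j => projRep k Q (y j)) := by
      by_contra hc
      have hepi : Epi (vmap g z) := inferInstance
      exact not_mem_supp_iff.2 ((not_mem_supp_iff.1 hc).of_epi (vmap g z)) hz
    obtain ⟨i, hi⟩ := exists_mem_supp_of_biproduct hz'
    exact ⟨y i, .inr ⟨i, rfl⟩, nonempty_path_of_mem_supp_projRep hi⟩

theorem repMinus.exists_finite {N : Repr k Q} (hN : repMinus k Q N) :
    ∃ G : Set Q, G.Finite ∧ (∀ y ∉ G, CofreeAt N y) ∧ supp N ⊆ predSet G := by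
  obtain ⟨m, n, x, y, f, g, h, hex, hf⟩ := hN
  refine ⟨Set.range x ∪ Set.range y, (Set.finite_range x).union (Set.finite_range y),
    fun z hz => ?_, fun z hz => ?_⟩
  · rw [Set.mem_union, not_or] at hz
    exact cofreeAt_of_exact hex hf
      (cofreeAt_biproduct fun i => cofreeAt_injRep fun e => hz.1 ⟨i, e.symm⟩)
      (cofreeAt_biproduct fun i => cofreeAt_injRep fun e => hz.2 ⟨i, e.symm⟩)
  · have hz' : z ∈ supp (⨁ fun j => injRep k Q (x j)) := by
      by_contra hc
      have hmono : Mono (vmap f z) := inferInstance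
      exact not_mem_supp_iff.2 ((not_mem_supp_iff.1 hc).of_mono (vmap f z)) hz
    obtain ⟨i, hi⟩ := exists_mem_supp_of_biproduct hz'
    exact ⟨x i, .inl ⟨i, rfl⟩, nonempty_path_of_mem_supp_injRep hi⟩

/-! ## Splitting the support -/

/-- Prescribing the identity on `α` and zero on the other arrows yields a retraction of `M(α)`, so
`M(x) ≠ 0` forces `M(y) ≠ 0`. This makes `SP` closed under all arrows of `Q`. -/
theorem RelFree.mem_supp {M : Repr k Q} {U : Set Q} {x y : Q} (h : RelFree M U y) (α : x ⟶ y)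
    (hxU : x ∈ U) (hx : x ∈ supp M) : y ∈ supp M := by
  classical
  by_contra hy
  let m : ∀ e : Σ z : Q, (z ⟶ y), (space M e.1 ⟶ space M x) :=
    Function.update (fun _ => 0) ⟨x, α⟩ (𝟙 (space M x))
  obtain ⟨g, hg, -⟩ := h.2 (space M x) fun z β => m ⟨z, β⟩
  have hid : arrowMap M α ≫ g = 𝟙 _ :=
    (hg x α hxU).trans (Function.update_self (β := fun e : Σ z : Q, (z ⟶ y) =>
      (space M e.1 ⟶ space M x)) ⟨x, α⟩ (𝟙 (space M x)) (fun _ => 0))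
  refine not_mem_supp_iff.2 ((IsZero.iff_id_eq_zero _).2 ?_) hx
  rw [← hid, (not_mem_supp_iff.1 hy).eq_of_src g 0, comp_zero]

theorem RelCofree.mem_supp {M : Repr k Q} {V : Set Q} {x y : Q} (h : RelCofree M V y) (α : y ⟶ x)
    (hxV : x ∈ V) (hx : x ∈ supp M) : y ∈ supp M := by
  classical
  by_contra hy
  let m : ∀ e : Σ z : Q, (y ⟶ z), (space M x ⟶ space M e.1) :=
    Function.update (fun _ => 0) ⟨x, α⟩ (𝟙 (space M x))
  obtain ⟨g, hg, -⟩ := h.2 (space M x) fun z β => m ⟨z, β⟩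
  have hid : g ≫ arrowMap M α = 𝟙 _ :=
    (hg x α hxV).trans (Function.update_self (β := fun e : Σ z : Q, (y ⟶ z) =>
      (space M x ⟶ space M e.1)) ⟨x, α⟩ (𝟙 (space M x)) (fun _ => 0))
  refine not_mem_supp_iff.2 ((IsZero.iff_id_eq_zero _).2 ?_) hx
  rw [← hid, (not_mem_supp_iff.1 hy).eq_of_tgt g 0, zero_comp]

theorem not_supportedByArrow_biprod {L N : Repr k Q} {x y : Q} (α : x ⟶ y)
    (hL : arrowMap L α = 0) (hN : arrowMap N α = 0) : ¬ SupportedByArrow (L ⊞ N) α := by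
  have h : vmap (biprod.fst : L ⊞ N ⟶ L) x ≫ vmap biprod.inl x +
      vmap (biprod.snd : L ⊞ N ⟶ N) x ≫ vmap biprod.inr x = 𝟙 _ :=
    congrArg (fun f => vmap f x) (biprod.total (X := L) (Y := N))
  rw [SupportedByArrow, not_not, ← Category.id_comp (arrowMap (L ⊞ N) α), ← h,
    Preadditive.add_comp, Category.assoc, Category.assoc, ← vmap_naturality, ← vmap_naturality,
    hL, hN, zero_comp, zero_comp, comp_zero, comp_zero, add_zero]

/-! ### Transfer of freeness and cofreeness from the ends of an extension to its middle term. -/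

section Extension

variable {L M N : Repr k Q} {f : L ⟶ M} {g : M ⟶ N} {h : f ≫ g = 0}

theorem isIso_vmap_left (hse : (ShortComplex.mk f g h).ShortExact) {x : Q} (hx : x ∉ supp N) :
    IsIso (vmap f x) := by
  have := hse.mono_f
  have hmono : Mono (vmap f x) := inferInstance
  have hepi : Epi (vmap f x) := (exact_vmap hse.exact x).epi_f ((not_mem_supp_iff.1 hx).eq_of_tgt _ _)
  exact isIso_of_mono_of_epi _

theorem isIso_vmap_right (hse : (ShortComplex.mk f g h).ShortExact) {x : Q} (hx : x ∉ supp L) :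
    IsIso (vmap g x) := by
  have := hse.epi_g
  have hepi : Epi (vmap g x) := inferInstance
  have hmono : Mono (vmap g x) :=
    (exact_vmap hse.exact x).mono_g ((not_mem_supp_iff.1 hx).eq_of_src _ _)
  exact isIso_of_mono_of_epi _

/-- At `y` and at its neighbours `z ∈ U` the map `L ⟶ M` is an isomorphism, so freeness carries
over. For `z ∉ U` both `L(z)` and `N(y)` vanish, so `α` does not support `L ⊕ N`, nor, by `hα`, `M`.
-/
theorem relFree_of_extension (hse : (ShortComplex.mk f g h).ShortExact) {U : Set Q} {y : Q}
    (hL : FreeAt L y) (hU : supp L ⊆ U) (hy : y ∉ supp N)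
    (hz : ∀ z, (z ⟶ y) → z ∈ U → z ∉ supp N)
    (hα : ∀ (z : Q) (α : z ⟶ y), SupportedByArrow M α → SupportedByArrow (L ⊞ N) α) :
    RelFree M U y := by
  have hLU {z : Q} (hz : z ∉ U) : IsZero (space L z) := not_mem_supp_iff.1 fun h => hz (hU h)
  have hiso := isIso_vmap_left hse hy
  refine ⟨fun z α hzU => ?_, fun W m => ?_⟩
  · by_contra hne
    exact not_supportedByArrow_biprod α ((hLU hzU).eq_of_src _ _)
      ((not_mem_supp_iff.1 hy).eq_of_tgt _ _) (hα z α hne)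
  · obtain ⟨b, hb, hb'⟩ := hL W fun z α => vmap f z ≫ m z α
    refine ⟨inv (vmap f y) ≫ b, fun z α hzU => ?_, fun c hc => ?_⟩
    · have := isIso_vmap_left hse (hz z α hzU)
      rw [← cancel_epi (vmap f z), ← Category.assoc, ← vmap_naturality, Category.assoc,
        IsIso.hom_inv_id_assoc, hb]
    · rw [IsIso.eq_inv_comp]
      refine hb' _ fun z α => ?_
      by_cases hzU : z ∈ U
      · rw [← Category.assoc, vmap_naturality, Category.assoc, hc z α hzU]
      · exact (hLU hzU).eq_of_src _ _

theorem relCofree_of_extension (hse : (ShortComplex.mk f g h).ShortExact) {V : Set Q} {y : Q}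
    (hN : CofreeAt N y) (hV : supp N ⊆ V) (hy : y ∉ supp L)
    (hz : ∀ z, (y ⟶ z) → z ∈ V → z ∉ supp L)
    (hα : ∀ (z : Q) (α : y ⟶ z), SupportedByArrow M α → SupportedByArrow (L ⊞ N) α) :
    RelCofree M V y := by
  have hNV {z : Q} (hz : z ∉ V) : IsZero (space N z) := not_mem_supp_iff.1 fun h => hz (hV h)
  have hiso := isIso_vmap_right hse hy
  refine ⟨fun z α hzV => ?_, fun W m => ?_⟩
  · by_contra hne
    exact not_supportedByArrow_biprod α ((not_mem_supp_iff.1 hy).eq_of_src _ _)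
      ((hNV hzV).eq_of_tgt _ _) (hα z α hne)
  · obtain ⟨b, hb, hb'⟩ := hN W fun z α => m z α ≫ vmap g z
    refine ⟨b ≫ inv (vmap g y), fun z α hzV => ?_, fun c hc => ?_⟩
    · have := isIso_vmap_right hse (hz z α hzV)
      rw [← cancel_mono (vmap g z), Category.assoc, vmap_naturality, Category.assoc,
        IsIso.inv_hom_id_assoc, hb]
    · rw [IsIso.eq_comp_inv]
      refine hb' _ fun z α => ?_
      by_cases hzV : z ∈ V
      · rw [Category.assoc, ← vmap_naturality, ← Category.assoc, hc z α hzV]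
      · exact (hNV hzV).eq_of_tgt _ _

theorem mem_supp_of_extension (hse : (ShortComplex.mk f g h).ShortExact) {x : Q}
    (hx : x ∈ supp M) : x ∈ supp L ∨ x ∈ supp N := by
  by_contra! hc
  have := isIso_vmap_left hse hc.2
  exact not_mem_supp_iff.2 ((not_mem_supp_iff.1 hc.1).of_iso (asIso (vmap f x)).symm) hx

end Extension

theorem exists_isFreeCofreePair (hQ : StronglyLocallyFinite Q) {M : Repr k Q} (hM : rrep k Q M) :
    ∃ U V SP SI : Set Q, IsFreeCofreePair M U V SP SI := by
  obtain ⟨-, L, N, hL, hN, ⟨f, g, w, hse⟩, hfin⟩ := hM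
  obtain ⟨F, hF, hLfree, hLU⟩ := repPlus.exists_finite hL
  obtain ⟨G, hG, hNcofree, hNV⟩ := repMinus.exists_finite hN
  let U := succSet F
  let V := predSet G
  let E := {e : Σ (x : Q) (y : Q), (x ⟶ y) |
      SupportedByArrow M e.2.2 ∧ ¬ SupportedByArrow (L ⊞ N) e.2.2}
  -- The finite bad set: where freeness may fail, where `L` and `N` may overlap, and the ends of the
  -- exceptional arrows.
  let H : Set Q := F ∪ G ∪ (U ∩ V) ∪ ((fun e => e.1) '' E ∪ (fun e => e.2.1) '' E)
  have hH : H.Finite := ((hF.union hG).union (hQ.finite_succSet_inter_predSet hF hG)).union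
    ((hfin.image _).union (hfin.image _))
  have hFH {x : Q} (hx : x ∈ F) : x ∈ H := .inl (.inl (.inl hx))
  have hGH {x : Q} (hx : x ∈ G) : x ∈ H := .inl (.inl (.inr hx))
  have hUV {x : Q} (hxU : x ∈ U) (hxV : x ∈ V) : x ∈ H := .inl (.inr ⟨hxU, hxV⟩)
  have hE {x y : Q} (α : x ⟶ y) (hxy : x ∉ H ∨ y ∉ H) (hα : SupportedByArrow M α) :
      SupportedByArrow (L ⊞ N) α := by
    by_contra hc
    have he : (⟨x, y, α⟩ : Σ (x : Q) (y : Q), (x ⟶ y)) ∈ E := ⟨hα, hc⟩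
    rcases hxy with hx | hy
    · exact hx (.inr (.inl ⟨_, he, rfl⟩))
    · exact hy (.inr (.inr ⟨_, he, rfl⟩))
  -- Neighbours are added because relative freeness at `y` also needs the sources of arrows into `y`
  -- to be good, and dually.
  let K : Set Q := H ∪ ((⋃ x ∈ H, Set.range fun e : Σ y : Q, (x ⟶ y) => e.1) ∪
    ⋃ y ∈ H, Set.range fun e : Σ x : Q, (x ⟶ y) => e.1)
  have hK : K.Finite := by
    refine hH.union ((hH.biUnion fun x _ => ?_).union (hH.biUnion fun y _ => ?_))
    · have := hQ.finite_out x
      exact Set.finite_range _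
    · have := hQ.finite_in y
      exact Set.finite_range _
  have hout {x y : Q} (α : x ⟶ y) (hx : x ∈ H) : y ∈ K :=
    .inr (.inl (Set.mem_biUnion hx ⟨⟨y, α⟩, rfl⟩))
  have hin {x y : Q} (α : x ⟶ y) (hy : y ∈ H) : x ∈ K :=
    .inr (.inr (Set.mem_biUnion hy ⟨⟨x, α⟩, rfl⟩))
  have hfree {y : Q} (hyU : y ∈ U) (hyK : y ∉ predSet K) : RelFree M U y := by
    have hyK' : y ∉ K := fun h => hyK (subset_predSet K h)
    have hyH : y ∉ H := fun h => hyK' (.inl h)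
    exact relFree_of_extension hse (hLfree y fun h => hyH (hFH h)) hLU
      (fun h => hyH (hUV hyU (hNV h)))
      (fun z α hzU hz => hyK' (hout α (hUV hzU (hNV hz)))) (fun z α => hE α (.inr hyH))
  have hcofree {y : Q} (hyV : y ∈ V) (hyK : y ∉ succSet K) : RelCofree M V y := by
    have hyK' : y ∉ K := fun h => hyK (subset_succSet K h)
    have hyH : y ∉ H := fun h => hyK' (.inl h)
    exact relCofree_of_extension hse (hNcofree y fun h => hyH (hGH h)) hNV
      (fun h => hyH (hUV (hLU h) hyV))
      (fun z α hzV hz => hyK' (hin α (hUV (hLU hz) hzV))) (fun z α => hE α (.inl hyH))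
  -- Removing all predecessors of `K`, not just `K`, makes the free part successor-closed; only
  -- finitely many vertices are lost, since `U ∩ predSet K` is finite.
  refine ⟨U, V, (supp M ∩ U) \ predSet K, (supp M ∩ V) \ succSet K, ?_, ?_, ?_, ?_, ?_⟩
  · refine ⟨fun x hx => hx.1.2, fun x hx => hx.1.1, fun x y α hx => ?_,
      fun y hy => hfree hy.1.2 hy.2, hQ.exists_rank_succSet hF, ?_⟩
    · have hyU : y ∈ U := mem_succSet_of_arrow α hx.1.2
      have hyK : y ∉ predSet K := fun h => hx.2 (mem_predSet_of_arrow α h)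
      exact ⟨⟨(hfree hyU hyK).mem_supp α hx.1.2 hx.1.1, hyU⟩, hyK⟩
    · refine (hQ.finite_succSet_inter_predSet hF hK).subset fun x hx => ⟨hx.1.2, ?_⟩
      by_contra hc
      exact hx.2 ⟨hx.1, hc⟩
  · refine ⟨fun x hx => hx.1.2, fun x hx => hx.1.1, fun x y α hy => ?_,
      fun y hy => hcofree hy.1.2 hy.2, hQ.exists_rank_predSet hG, ?_⟩
    · have hxV : x ∈ V := mem_predSet_of_arrow α hy.1.2
      have hxK : x ∉ succSet K := fun h => hy.2 (mem_succSet_of_arrow α h)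
      exact ⟨⟨(hcofree hxV hxK).mem_supp α hy.1.2 hy.1.1, hxV⟩, hxK⟩
    · refine (hQ.finite_succSet_inter_predSet hK hG).subset fun x hx => ⟨?_, hx.1.2⟩
      by_contra hc
      exact hx.2 ⟨hx.1, hc⟩
  · exact fun x hx => (mem_supp_of_extension hse hx).imp (fun h => hLU h) (fun h => hNV h)
  · exact fun x hx hxV => hx.2 (subset_predSet K (.inl (hUV hx.1.2 hxV)))
  · exact fun x hx hxU => hx.2 (subset_succSet K (.inl (hUV hxU hx.1.2)))

end

end QuiverRep

theorem mainTheorem12 {k : Type u} [Field k] {Q : Type v} [Quiver.{w} Q]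
    (hQ : QuiverRep.StronglyLocallyFinite Q)
    (M : QuiverRep.Repr k Q) (hM : QuiverRep.rrep k Q M) (hM0 : ¬ IsZero M) :
    ∃ SP SI : Set Q, QuiverRep.IsSplitting M SP SI ∧
      ∀ SP' SI' : Set Q,
        QuiverRep.CofiniteIn SP' SP → QuiverRep.SuccessorClosedIn SP' SP →
        QuiverRep.CofiniteIn SI' SI → QuiverRep.PredecessorClosedIn SI' SI →
        QuiverRep.IsSplitting M SP' SI' := by
  obtain ⟨U, V, SP, SI, h⟩ := QuiverRep.exists_isFreeCofreePair hQ hM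
  exact ⟨SP, SI, h.isSplitting hQ hM.1 hM0, fun SP' SI' hP hP' hI hI' =>
    (h.mono hP hP' hI hI').isSplitting hQ hM.1 hM0⟩
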